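/- All graphs are finite and simple. First-order sentences about graphs are built from variables ranging over vertices, the relations $=$ and $\sim$ (adjacency), the Boolean connectives and the quantifiers $\forall,\exists$. The depth of a sentence is the maximum length of a chain of nested quantifiers; its alternation number is the maximum number of changes between $\exists$ and $\forall$ along a chain of nested quantifiers after all negations have been pushed down to the atomic formulas. A sentence defines a graph $G$ if it is true on $G$ and false on every graph not isomorphic to $G$. Let $D(G)$ be the smallest depth of a sentence defining $G$, and let $D_2(G)$ be the smallest depth of a sentence that defines $G$ and has alternation number at most $2$. Let $\mathcal G(n,\frac12)$ be the random graph on $n$ labelled vertices in which each edge is present independently with probability $\frac12$, and put $$L(n)=\log_2 n-2\log_2\ln n+\log_2\ln 2 .$$ Theorem. There are a strictly increasing sequence of natural numbers $n_0<n_1<n_2<\dots$, reals $\varepsilon_j\to0$ and integers $a_j\ge 0$ such that for $G\in\mathcal G(n_j,\frac12)$, each of the following holds with probability tending to $1$ as $j\to\infty$: 1. $D_2(G)\le L(n_j)+6+\varepsilon_j$; 2. $D(G)\ge L(n_j)+1-\varepsilon_j$; 3. $D(G)$ and $D_2(G)$ both belong to the set $\{a_j,a_j+1,a_j+2,a_j+3,a_j+4\}$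 of five consecutive integers. -/

import Mathlib

namespace FirstOrderComplexity

open FirstOrder

/-- Quantifier depth: the length of a longest chain of nested quantifiers. -/
def quantDepth {α : Type} : {n : ℕ} → Language.graph.BoundedFormula α n → ℕ
  | _, .falsum => 0
  | _, .equal _ _ => 0
  | _, .rel _ _ => 0
  | _, .imp φ ψ => max (quantDepth φ) (quantDepth ψ)
  | _, .all φ => quantDepth φ + 1

/-- The largest number of changes between `∀` and `∃` along a chain of nested quantifiers, once all
negations have been pushed down to the atomic formulas.

Mathlib builds formulas from `⊥`, `→` and `∀` (so `¬ φ` is `φ → ⊥` and `∃ x φ` is `¬ ∀ x ¬ φ`).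
The argument `pos` says whether the current subformula occurs positively (under an even number of
negations or left sides of implications); a `∀` is universal in the negation normal form if it
occurs positively, and existential if it occurs negatively. The argument `last` is the kind of the
closest enclosing quantifier, if there is one (`true` for universal, `false` for existential). -/
def altFrom {α : Type} :
    {n : ℕ} → Language.graph.BoundedFormula α n → (pos : Bool) → (last : Option Bool) → ℕ
  | _, .falsum, _, _ => 0
  | _, .equal _ _, _, _ => 0
  | _, .rel _ _, _, _ => 0
  | _, .imp φ ψ, pos, last => max (altFrom φ (!pos) last) (altFrom ψ pos last)
  | _, .all φ, pos, last => altFrom φ pos (some pos) + if last = some (!pos) then 1 else 0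

/-- The alternation number of a formula. -/
def alternationNumber {α : Type} {n : ℕ} (φ : Language.graph.BoundedFormula α n) : ℕ :=
  altFrom φ true none

/-- `G ⊨ A`. -/
def Satisfies {V : Type} (G : SimpleGraph V) (A : Language.graph.Sentence) : Prop :=
  @Language.Sentence.Realize Language.graph V G.structure A

/-- The sentence `A` defines `G`: it holds on `G`, and it fails on every (finite) graph that is not
isomorphic to `G`. -/
def Defines {V : Type} (A : Language.graph.Sentence) (G : SimpleGraph V) : Prop :=
  Satisfies G A ∧
    ∀ (W : Type) [Finite W] (H : SimpleGraph W), ¬ Nonempty (G ≃g H) → ¬ Satisfies H A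

/-- `D(G)`: the smallest quantifier depth of a sentence that defines `G`
(`⊤` if there were no such sentence). -/
noncomputable def defDepth {V : Type} (G : SimpleGraph V) : ℕ∞ :=
  ⨅ (A : Language.graph.Sentence) (_ : Defines A G), (quantDepth A : ℕ∞)

/-- `D_r(G)`: the smallest quantifier depth of a sentence that defines `G` and has alternation
number at most `r` (`⊤` if there were no such sentence). -/
noncomputable def defDepthAlt (r : ℕ) {V : Type} (G : SimpleGraph V) : ℕ∞ :=
  ⨅ (A : Language.graph.Sentence) (_ : Defines A G ∧ alternationNumber A ≤ r),
    (quantDepth A : ℕ∞)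

/-- The edge probability `1/2`. -/
noncomputable def half : unitInterval := ⟨1 / 2, by norm_num, by norm_num⟩

/-- The probability that `G ∈ G(n, 1/2)` has the property `P`. -/
noncomputable def prob (n : ℕ) (P : SimpleGraph (Fin n) → Prop) : ℝ :=
  (SimpleGraph.binomialRandom (Fin n) half).real {G | P G}

/-- `log₂ n - 2 log₂ ln n + log₂ ln 2`. -/
noncomputable def mainTerm (n : ℕ) : ℝ :=
  Real.logb 2 n - 2 * Real.logb 2 (Real.log n) + Real.logb 2 (Real.log 2)

end FirstOrderComplexity

namespace FirstOrderComplexity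

open FirstOrder

/-! ### Logic: counting quantifier alternations, a defining sentence, and a depth lower bound -/

section Logic

open Language

variable {m d e u : ℕ}

/-! Take `n = k² 2^(k-1)` vertices and `q = 2^(-k)`, so that a fixed `k`-set has about `nq = k²/2`
common neighbours. It is shown that, with high probability, `k + 1 ≤ D ≤ D₂ ≤ k + 4`
(`tendsto_prob_hasDepths`). Since `ln n` is close to `k ln 2`, `k - 2 ≤ L(n) ≤ k` for large `k`, and
the theorem follows with all error terms equal to zero.

Lower bound. With high probability every adjacency pattern on at most `k - 1` vertices is realised.
Two graphs with this property agree on all sentences of depth at most `k`, by the usual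
back-and-forth argument (`realize_iff_of_sameType`). A larger graph with the property exists, so
depth `k` defines nothing here.

Upper bound. A vertex `w` is pinned if it is the unique common neighbour of a `k`-tuple whose atomic
type never yields another such vertex. Being pinned by a given type costs `k` existential
quantifiers and one universal one. If any two vertices are separated by a pinned vertex, one more
existential quantifier recognises each vertex by its adjacencies to pinned vertices, and two further
quantifiers describe the whole graph: depth `k + 4`, at most two alternations
(`defDepthAlt_le_of_isPinned`).

Most vertices are pinned. For fixed `w`, a tuple isolates `w` with probability `p ≈ q exp(-k²/2)`,
tiny but outweighed by the number of tuples. Chebyshev over the `2^(k²)` transversals of `k`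
disjoint blocks of size `2^k` shows that the count is near its mean (`isolates_pair_bound`). By a
union bound, an isolating tuple also has a rival of the same type with probability about
`exp(-9k²/16)`, negligible against `p` since `9/16 > 1/2` (`coincidence_bound`). So fewer than
`2^(k-3)` vertices fail to be pinned. The extension property supplies `2^(k-3)` vertices separating
any given pair, so one of them is pinned (`exists_isPinned_of_hasExtension`). -/

theorem altFrom_not_not {n : ℕ} (φ : Language.graph.BoundedFormula Empty n) (pos : Bool)
    (last : Option Bool) : altFrom φ (!pos) (last.map not) = altFrom φ pos last := by
  induction φ generalizing pos last with
  | falsum => rfl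
  | equal _ _ => rfl
  | rel _ _ => rfl
  | imp φ ψ h₁ h₂ => simp only [altFrom, h₁, h₂]
  | all φ h =>
    have := h pos (some pos)
    simp only [Option.map_some] at this
    simp only [altFrom, this]
    congr 1
    rcases last with _ | b
    · simp
    · cases b <;> cases pos <;> simp

theorem altFrom_none_le {n : ℕ} (φ : Language.graph.BoundedFormula Empty n) (pos : Bool)
    (last : Option Bool) : altFrom φ pos none ≤ altFrom φ pos last := by
  induction φ generalizing pos with
  | falsum => exact le_rfl
  | equal _ _ => exact le_rfl
  | rel _ _ => exact le_rfl
  | imp φ ψ h₁ h₂ => exact max_le_max (h₁ _) (h₂ _)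
  | all φ h => simp [altFrom]

/-- The property `P` of graphs with `m` marked vertices is expressed by a formula of depth at most
`d` whose alternation number is at most `e` below an existential quantifier and at most `u` below a
universal one. -/
def Expressible (m d e u : ℕ) (P : ∀ W : Type, SimpleGraph W → (Fin m → W) → Prop) : Prop :=
  ∃ φ : Language.graph.BoundedFormula Empty m, quantDepth φ ≤ d ∧
    altFrom φ true (some false) ≤ e ∧ altFrom φ true (some true) ≤ u ∧
    ∀ (W : Type) (H : SimpleGraph W) (v : Empty → W) (xs : Fin m → W),
      @BoundedFormula.Realize _ W H.structure _ _ φ v xs ↔ P W H xs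

namespace Expressible

variable {P Q : ∀ W : Type, SimpleGraph W → (Fin m → W) → Prop}

theorem congr (h : Expressible m d e u P)
    (hPQ : ∀ (W : Type) (H : SimpleGraph W) (xs : Fin m → W), P W H xs ↔ Q W H xs) :
    Expressible m d e u Q := by
  obtain ⟨φ, h₁, h₂, h₃, h₄⟩ := h
  exact ⟨φ, h₁, h₂, h₃, fun W H v xs => (h₄ W H v xs).trans (hPQ W H xs)⟩

theorem mono {d' e' u' : ℕ} (h : Expressible m d e u P) (hd : d ≤ d') (he : e ≤ e')
    (hu : u ≤ u') : Expressible m d' e' u' P := by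
  obtain ⟨φ, h₁, h₂, h₃, h₄⟩ := h
  exact ⟨φ, h₁.trans hd, h₂.trans he, h₃.trans hu, h₄⟩

theorem falsum : Expressible m d e u (fun _ _ _ => False) :=
  ⟨.falsum, by simp [quantDepth], by simp [altFrom], by simp [altFrom], fun _ _ _ _ => Iff.rfl⟩

theorem eq (i j : Fin m) : Expressible m d e u (fun _ _ xs => xs i = xs j) :=
  ⟨.equal (Term.var (Sum.inr i)) (Term.var (Sum.inr j)), by simp [quantDepth], by simp [altFrom],
    by simp [altFrom], fun _ _ _ _ => Iff.rfl⟩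

theorem adj (i j : Fin m) : Expressible m d e u (fun _ H xs => H.Adj (xs i) (xs j)) :=
  ⟨Relations.boundedFormula₂ Language.adj (Term.var (Sum.inr i)) (Term.var (Sum.inr j)),
    by simp [quantDepth, Relations.boundedFormula₂, Relations.boundedFormula],
    by simp [altFrom, Relations.boundedFormula₂, Relations.boundedFormula],
    by simp [altFrom, Relations.boundedFormula₂, Relations.boundedFormula],
    fun _ _ _ _ => Iff.rfl⟩

theorem not (h : Expressible m d e u P) : Expressible m d u e (fun W H xs => ¬ P W H xs) := by
  obtain ⟨φ, h₁, h₂, h₃, h₄⟩ := h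
  refine ⟨φ.imp .falsum, by simpa [quantDepth] using h₁, ?_, ?_, fun W H v xs => ?_⟩
  · have := altFrom_not_not φ true (some true)
    simp only [Option.map_some, Bool.not_true] at this
    simpa [altFrom, this] using h₃
  · have := altFrom_not_not φ true (some false)
    simp only [Option.map_some, Bool.not_true, Bool.not_false] at this
    simpa [altFrom, this] using h₂
  · exact not_congr (h₄ W H v xs)

theorem imp (h : Expressible m d u e P) (h' : Expressible m d e u Q) :
    Expressible m d e u (fun W H xs => P W H xs → Q W H xs) := by
  obtain ⟨φ, h₁, h₂, h₃, h₄⟩ := h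
  obtain ⟨ψ, h₁', h₂', h₃', h₄'⟩ := h'
  refine ⟨φ.imp ψ, max_le h₁ h₁', max_le ?_ h₂', max_le ?_ h₃', fun W H v xs => ?_⟩
  · have := altFrom_not_not φ true (some true)
    simp only [Option.map_some, Bool.not_true] at this
    simpa [this] using h₃
  · have := altFrom_not_not φ true (some false)
    simp only [Option.map_some, Bool.not_true, Bool.not_false] at this
    simpa [this] using h₂
  · exact imp_congr (h₄ W H v xs) (h₄' W H v xs)

theorem verum : Expressible m d e u (fun _ _ _ => True) :=
  (Expressible.falsum.not).congr fun _ _ _ => by simp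

theorem and (h : Expressible m d e u P) (h' : Expressible m d e u Q) :
    Expressible m d e u (fun W H xs => P W H xs ∧ Q W H xs) :=
  (h.imp h'.not).not.congr fun _ _ _ => by tauto

theorem iff_const (h : Expressible m d e e P) (c : Prop) :
    Expressible m d e e (fun W H xs => P W H xs ↔ c) := by
  by_cases hc : c
  · exact h.congr fun _ _ _ => by simp [hc]
  · exact h.not.congr fun _ _ _ => by simp [hc]

theorem forall_finite {ι : Type} [Finite ι]
    {R : ι → ∀ W : Type, SimpleGraph W → (Fin m → W) → Prop}
    (h : ∀ i, Expressible m d e u (R i)) :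
    Expressible m d e u (fun W H xs => ∀ i, R i W H xs) := by
  classical
  have := Fintype.ofFinite ι
  suffices ∀ s : Finset ι, Expressible m d e u (fun W H xs => ∀ i ∈ s, R i W H xs) from
    (this Finset.univ).congr fun _ _ _ => by simp
  intro s
  induction s using Finset.induction_on with
  | empty => exact Expressible.verum.congr fun _ _ _ => by simp
  | insert a s _ ih => exact ((h a).and ih).congr fun _ _ _ => by simp

theorem exists_finite {ι : Type} [Finite ι]
    {R : ι → ∀ W : Type, SimpleGraph W → (Fin m → W) → Prop}
    (h : ∀ i, Expressible m d e u (R i)) :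
    Expressible m d e u (fun W H xs => ∃ i, R i W H xs) :=
  (forall_finite fun i => (h i).not).not.congr fun _ _ _ => by simp

/-- A new universal quantifier makes the old formula sit below a universal one, so only the bound
`u` survives; the change is paid for when the enclosing quantifier is existential. -/
theorem all {R : ∀ W : Type, SimpleGraph W → (Fin m → W) → W → Prop}
    (h : Expressible (m + 1) d e u
      (fun W H ys => R W H (fun i => ys i.castSucc) (ys (Fin.last m)))) :
    Expressible m (d + 1) (u + 1) u (fun W H xs => ∀ a, R W H xs a) := by
  obtain ⟨φ, h₁, h₂, h₃, h₄⟩ := h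
  refine ⟨φ.all, Nat.succ_le_succ h₁, ?_, ?_, fun W H v xs => ?_⟩
  · simpa [altFrom] using h₃
  · simpa [altFrom] using h₃
  · refine forall_congr' fun a => (h₄ W H v _).trans ?_
    simp

theorem ex {R : ∀ W : Type, SimpleGraph W → (Fin m → W) → W → Prop}
    (h : Expressible (m + 1) d e u
      (fun W H ys => R W H (fun i => ys i.castSucc) (ys (Fin.last m)))) :
    Expressible m (d + 1) e (e + 1) (fun W H xs => ∃ a, R W H xs a) :=
  (Expressible.all (R := fun W H xs a => ¬ R W H xs a) h.not).not.congr fun _ _ _ => by simp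

/-- A block of like quantifiers costs depth `k` but at most one alternation, whatever its length.
The hypotheses relating `e` and `u` let the empty block satisfy the same bounds. -/
theorem exs {k : ℕ} {R : ∀ W : Type, SimpleGraph W → (Fin m → W) → (Fin k → W) → Prop}
    (he : e ≤ u) (hu : u ≤ e + 1)
    (h : Expressible (m + k) d e u
      (fun W H ys => R W H (fun i => ys (i.castAdd k)) (fun i => ys (i.natAdd m)))) :
    Expressible m (d + k) e (e + 1) (fun W H xs => ∃ ys, R W H xs ys) := by
  induction k generalizing d u with
  | zero =>
    refine (h.mono le_rfl le_rfl hu).congr fun W H xs => ?_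
    constructor
    · intro hR
      exact ⟨_, hR⟩
    · rintro ⟨ys, hR⟩
      rwa [Subsingleton.elim ys fun i => xs (i.natAdd m)] at hR
  | succ k ih =>
    have h' : Expressible (m + k) (d + 1) e (e + 1) (fun W H zs => ∃ a,
        R W H (fun i => zs (i.castAdd k)) (Fin.snoc (fun i => zs (i.natAdd m)) a)) := by
      refine Expressible.ex (R := fun W H zs a =>
        R W H (fun i => zs (i.castAdd k)) (Fin.snoc (fun i => zs (i.natAdd m)) a))
        (h.congr fun W H ys => ?_)
      refine iff_of_eq ?_
      congr 1
      funext i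
      refine Fin.lastCases ?_ (fun i => ?_) i
      · rw [Fin.snoc_last]; rfl
      · rw [Fin.snoc_castSucc]; rfl
    have h'' := ih (R := fun W H xs zs => ∃ a, R W H xs (Fin.snoc zs a)) (by omega) le_rfl h'
    refine (h''.mono (by omega) le_rfl le_rfl).congr fun W H xs => ?_
    constructor
    · rintro ⟨ys, a, hR⟩
      exact ⟨_, hR⟩
    · rintro ⟨ys, hR⟩
      refine ⟨fun i => ys i.castSucc, ys (Fin.last k), ?_⟩
      convert hR using 1
      exact Fin.snoc_init_self ys

end Expressible

/-! ### Pinned vertices and the defining sentence of depth `k + 4` -/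

/-- `w` is the only common neighbour of the vertices `X i`. -/
def IsUniqueCommonNbr {W : Type} {k : ℕ} (H : SimpleGraph W) (X : Fin k → W) (w : W) : Prop :=
  ∀ z, (∀ i, H.Adj z (X i)) ↔ z = w

/-- The tuples `X` and `Y` have the same atomic type. -/
def SameType {V W : Type} {k : ℕ} (G : SimpleGraph V) (X : Fin k → V) (H : SimpleGraph W)
    (Y : Fin k → W) : Prop :=
  ∀ i j, (Y i = Y j ↔ X i = X j) ∧ (H.Adj (Y i) (Y j) ↔ G.Adj (X i) (X j))

theorem SameType.refl {V : Type} {k : ℕ} (G : SimpleGraph V) (X : Fin k → V) :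
    SameType G X G X := fun _ _ => ⟨Iff.rfl, Iff.rfl⟩

/-- `w` is the only common neighbour of some `k`-tuple, and no other vertex is the only common
neighbour of a `k`-tuple of the same atomic type. -/
def IsPinned {V : Type} (k : ℕ) (G : SimpleGraph V) (w : V) : Prop :=
  ∃ X : Fin k → V, IsUniqueCommonNbr G X w ∧
    ∀ (Y : Fin k → V) (y : V), SameType G X G Y → IsUniqueCommonNbr G Y y → y = w

theorem expressible_uniqueCommonNbr {V : Type} {k : ℕ} (G : SimpleGraph V) (X : Fin k → V)
    (i : Fin m) : Expressible m (k + 1) 1 2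
      (fun W H xs => ∃ Y : Fin k → W, SameType G X H Y ∧ IsUniqueCommonNbr H Y (xs i)) := by
  have h : Expressible (m + k) 1 1 1 (fun W H ys =>
      SameType G X H (fun i => ys (i.natAdd m)) ∧
        IsUniqueCommonNbr H (fun i => ys (i.natAdd m)) (ys (i.castAdd k))) := by
    refine .and (.forall_finite fun a => .forall_finite fun b => .and
      (.iff_const (.eq _ _) _) (.iff_const (.adj _ _) _)) ?_
    refine (Expressible.all (e := 0) (u := 0) (R := fun W H ys z =>
      ((∀ j, H.Adj z (ys (Fin.natAdd m j))) ↔ z = ys (i.castAdd k))) ?_).mono le_rfl le_rfl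
        (Nat.zero_le _)
    have h₁ : Expressible (m + k + 1) 0 0 0 (fun W H ys =>
        ∀ j : Fin k, H.Adj (ys (Fin.last _)) (ys (Fin.natAdd m j).castSucc)) :=
      .forall_finite fun j => .adj _ _
    have h₂ : Expressible (m + k + 1) 0 0 0 (fun W H ys =>
        ys (Fin.last _) = ys (Fin.castAdd k i).castSucc) := .eq _ _
    exact ((h₁.imp h₂).and (h₂.imp h₁)).congr fun W H ys =>
      iff_iff_implies_and_implies.symm
  exact (Expressible.exs (R := fun W H xs Y => SameType G X H Y ∧ IsUniqueCommonNbr H Y (xs i))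
    le_rfl (by norm_num) h).mono (by omega) le_rfl le_rfl

/-- The sentence has three clauses, all phrased by adjacency patterns to pinned vertices: every pair
of patterns is realised with the right equality and adjacency, every vertex has a pattern, and no
pattern occurs twice. In any model the patterns then give a bijection preserving adjacency. -/
theorem defDepthAlt_le_of_isPinned {V : Type} [Finite V] {k : ℕ} (G : SimpleGraph V)
    (hsep : ∀ u v : V, u ≠ v → ∃ w, IsPinned k G w ∧ ¬ (G.Adj u w ↔ G.Adj v w)) :
    defDepthAlt 2 G ≤ (k + 4 : ℕ) := by
  choose X hX hX' using fun w : {w // IsPinned k G w} => w.2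
  let Near (w : {w // IsPinned k G w}) (W : Type) (H : SimpleGraph W) (a : W) : Prop :=
    ∃ Y : Fin k → W, SameType G (X w) H Y ∧ IsUniqueCommonNbr H Y a
  -- An existential choice of `b` suffices: in `G` it is forced, and in another graph the uniqueness
  -- clause for patterns makes uniqueness of `b` unnecessary. This keeps the alternations down.
  let Pat (v : V) (W : Type) (H : SimpleGraph W) (a : W) : Prop :=
    ∀ w, ∃ b, Near w W H b ∧ (H.Adj a b ↔ G.Adj v w)
  have hNear : ∀ w b, Near w V G b ↔ b = w := by
    refine fun w b => ⟨fun ⟨Y, hY, hb⟩ => hX' w Y b hY hb, ?_⟩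
    rintro rfl
    exact ⟨X w, .refl _ _, hX w⟩
  have hPat : ∀ v a, Pat v V G a ↔ a = v := by
    refine fun v a => ⟨fun h => ?_, ?_⟩
    · by_contra hne
      obtain ⟨w, hw, hw'⟩ := hsep _ _ hne
      obtain ⟨b, hb, hb'⟩ := h ⟨w, hw⟩
      rw [hNear] at hb
      subst hb
      exact hw' hb'
    · rintro rfl w
      exact ⟨w, (hNear _ _).2 rfl, Iff.rfl⟩
  have ePat : ∀ (v : V) (m : ℕ) (i : Fin m),
      Expressible m (k + 2) 1 2 (fun W H xs => Pat v W H (xs i)) := by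
    refine fun v m i => .forall_finite fun w => ?_
    refine Expressible.ex (u := 2) (R := fun W H xs b =>
      Near w W H b ∧ (H.Adj (xs i) b ↔ G.Adj v w)) ?_
    refine (expressible_uniqueCommonNbr G (X w) (Fin.last m)).and
      ((Expressible.iff_const (e := 1) ?_ _).mono le_rfl le_rfl (by norm_num))
    exact .adj _ _
  have e₁ : Expressible 0 (k + 4) 3 2 (fun W H _ => ∀ v v' : V, ∃ a b : W, Pat v W H a ∧
      Pat v' W H b ∧ (a = b ↔ v = v') ∧ (H.Adj a b ↔ G.Adj v v')) := by
    refine .forall_finite fun v => .forall_finite fun v' => ?_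
    refine (Expressible.ex (e := 1) (u := 2) (R := fun W H _ a => ∃ b : W, Pat v W H a ∧
      Pat v' W H b ∧ (a = b ↔ v = v') ∧ (H.Adj a b ↔ G.Adj v v')) ?_).mono le_rfl (by norm_num)
        (by norm_num)
    refine Expressible.ex (e := 1) (u := 2) (R := fun W H xs b => Pat v W H (xs (Fin.last 0)) ∧
      Pat v' W H b ∧ (xs (Fin.last 0) = b ↔ v = v') ∧ (H.Adj (xs (Fin.last 0)) b ↔ G.Adj v v')) ?_
    refine (ePat v _ _).and ((ePat v' _ _).and (.and ?_ ?_))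
    · exact (Expressible.iff_const (e := 1) (.eq _ _) _).mono le_rfl le_rfl (by norm_num)
    · exact (Expressible.iff_const (e := 1) (.adj _ _) _).mono le_rfl le_rfl (by norm_num)
  have e₂ : Expressible 0 (k + 4) 3 2 (fun W H _ => ∀ a : W, ∃ v, Pat v W H a) :=
    (Expressible.all (e := 1) (u := 2) (R := fun W H _ a => ∃ v, Pat v W H a)
      (.exists_finite fun v => ePat v _ _)).mono (by omega) (by norm_num) le_rfl
  have e₃ : Expressible 0 (k + 4) 3 2 (fun W H _ => ∀ a b : W, ∀ v,
      Pat v W H a → Pat v W H b → a = b) := by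
    refine (Expressible.all (e := 2) (u := 1) (R := fun W H _ a => ∀ b : W, ∀ v,
      Pat v W H a → Pat v W H b → a = b) ?_).mono le_rfl (by norm_num) (by norm_num)
    refine Expressible.all (e := 2) (u := 1) (R := fun W H xs b => ∀ v,
      Pat v W H (xs (Fin.last 0)) → Pat v W H b → xs (Fin.last 0) = b) ?_
    exact .forall_finite fun v => .imp (ePat v _ _) (.imp (ePat v _ _) (.eq _ _))
  obtain ⟨φ, h₁, h₂, h₃, h₄⟩ := e₁.and (e₂.and e₃)
  -- The alternation number is bounded by the count below a fictitious universal quantifier, which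
  -- costs nothing for the clauses starting with `∀` and leaves room for the existential one.
  refine (iInf₂_le φ ⟨⟨?_, ?_⟩, (altFrom_none_le φ _ _).trans h₃⟩).trans (by exact_mod_cast h₁)
  · refine (h₄ V G _ _).2 ⟨fun v v' => ⟨v, v', (hPat _ _).2 rfl, (hPat _ _).2 rfl, Iff.rfl, Iff.rfl⟩,
      fun a => ⟨a, (hPat _ _).2 rfl⟩, fun a b v ha hb => ?_⟩
    rw [hPat] at ha hb
    rw [ha, hb]
  · intro W _ H hiso hsat
    obtain ⟨g₁, g₂, g₃⟩ := (h₄ W H _ _).1 hsat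
    refine hiso ?_
    have : ∀ v, ∃ a, Pat v W H a := fun v => by
      obtain ⟨a, -, ha, -⟩ := g₁ v v
      exact ⟨a, ha⟩
    choose f hf using this
    have hfe : ∀ v v', (f v = f v' ↔ v = v') ∧ (H.Adj (f v) (f v') ↔ G.Adj v v') := by
      intro v v'
      obtain ⟨a, b, ha, hb, hab⟩ := g₁ v v'
      rw [g₃ _ _ v (hf v) ha, g₃ _ _ v' (hf v') hb]
      exact hab
    have hbij : Function.Bijective f := by
      refine ⟨fun v v' h => (hfe v v').1.1 h, fun a => ?_⟩
      obtain ⟨v, hv⟩ := g₂ a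
      exact ⟨v, g₃ _ _ v (hf v) hv⟩
    exact ⟨⟨Equiv.ofBijective f hbij, fun {v v'} => (hfe v v').2⟩⟩

/-! ### Extension properties and the lower bound -/

/-- Every adjacency pattern on every set of `M` vertices is realised by a vertex outside. -/
def HasExtension {V : Type} (M : ℕ) (G : SimpleGraph V) : Prop :=
  ∀ S T : Finset V, S.card ≤ M → ∃ z ∉ S, ∀ x ∈ S, G.Adj z x ↔ x ∈ T

theorem HasExtension.mono {V : Type} {M N : ℕ} {G : SimpleGraph V} (h : HasExtension N G)
    (hMN : M ≤ N) : HasExtension M G := fun S T hS => h S T (hS.trans hMN)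

theorem exists_sameType_snoc {V W : Type} {M : ℕ} {G : SimpleGraph V} {H : SimpleGraph W}
    (hH : HasExtension M H) {m : ℕ} (hm : m ≤ M) {xs : Fin m → V} {ys : Fin m → W}
    (h : SameType G xs H ys) (a : V) :
    ∃ b : W, SameType G (Fin.snoc xs a : Fin (m + 1) → V) H (Fin.snoc ys b : Fin (m + 1) → W) := by
  classical
  by_cases ha : ∃ i, xs i = a
  · obtain ⟨i, rfl⟩ := ha
    refine ⟨ys i, fun j₁ j₂ => ?_⟩
    refine Fin.lastCases ?_ (fun j₁ => ?_) j₁ <;> refine Fin.lastCases ?_ (fun j₂ => ?_) j₂ <;>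
      simp [h _ _]
  · push Not at ha
    obtain ⟨b, hb, hb'⟩ := hH (Finset.univ.image ys)
      ((Finset.univ.filter fun i => G.Adj a (xs i)).image ys)
      (Finset.card_image_le.trans (by simpa using hm))
    have hb₁ : ∀ i, ys i ≠ b := by simpa using hb
    have hb₂ : ∀ i, H.Adj b (ys i) ↔ G.Adj a (xs i) := by
      intro i
      rw [hb' (ys i) (by simp)]
      simp only [Finset.mem_image, Finset.mem_filter, Finset.mem_univ, true_and]
      constructor
      · rintro ⟨j, hj, hji⟩
        rwa [((h j i).1).1 hji] at hj
      · exact fun hi => ⟨i, hi, rfl⟩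
    refine ⟨b, fun j₁ j₂ => ?_⟩
    refine Fin.lastCases ?_ (fun j₁ => ?_) j₁ <;> refine Fin.lastCases ?_ (fun j₂ => ?_) j₂
    · simp
    · simp [(hb₁ _).symm, (ha _).symm, hb₂]
    · simp [hb₁, ha, H.adj_comm _ b, G.adj_comm _ a, hb₂]
    · simp [h _ _]

theorem SameType.symm {V W : Type} {k : ℕ} {G : SimpleGraph V} {X : Fin k → V} {H : SimpleGraph W}
    {Y : Fin k → W} (h : SameType G X H Y) : SameType H Y G X :=
  fun i j => ⟨(h i j).1.symm, (h i j).2.symm⟩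

theorem graph_term_eq_var {α : Type} : ∀ t : Language.graph.Term α, ∃ a, t = Term.var a
  | .var a => ⟨a, rfl⟩
  | .func f _ => f.elim

/-- Duplicator's strategy: before each move at most `M` vertices are marked, so the extension
property answers any new vertex. The budget `M + 1` is right because the last marked vertex needs no
further extension. -/
theorem realize_iff_of_sameType {V W : Type} {M : ℕ} {G : SimpleGraph V} {H : SimpleGraph W}
    (hG : HasExtension M G) (hH : HasExtension M H) (v : Empty → V) (v' : Empty → W) {m : ℕ}
    (φ : Language.graph.BoundedFormula Empty m) (hm : m + quantDepth φ ≤ M + 1)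
    {xs : Fin m → V} {ys : Fin m → W} (h : SameType G xs H ys) :
    @BoundedFormula.Realize _ V G.structure _ _ φ v xs ↔
      @BoundedFormula.Realize _ W H.structure _ _ φ v' ys := by
  induction φ with
  | falsum => exact Iff.rfl
  | equal t₁ t₂ =>
    obtain ⟨a | i, rfl⟩ := graph_term_eq_var t₁
    · exact a.elim
    obtain ⟨a | j, rfl⟩ := graph_term_eq_var t₂
    · exact a.elim
    exact (h i j).1.symm
  | rel R ts =>
    cases R
    obtain ⟨a | i, hi⟩ := graph_term_eq_var (ts 0)
    · exact a.elim
    obtain ⟨a | j, hj⟩ := graph_term_eq_var (ts 1)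
    · exact a.elim
    change G.Adj (@Term.realize _ _ G.structure _ _ (ts 0))
      (@Term.realize _ _ G.structure _ _ (ts 1)) ↔ H.Adj (@Term.realize _ _ H.structure _ _ (ts 0))
      (@Term.realize _ _ H.structure _ _ (ts 1))
    rw [hi, hj]
    exact (h i j).2.symm
  | imp φ ψ h₁ h₂ =>
    simp only [quantDepth] at hm
    exact imp_congr (h₁ (by omega) h) (h₂ (by omega) h)
  | all φ ih =>
    simp only [quantDepth] at hm
    constructor
    · intro hall b
      obtain ⟨a, ha⟩ := exists_sameType_snoc hG (by omega) h.symm b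
      exact (ih (by omega) ha.symm).1 (hall a)
    · intro hall a
      obtain ⟨b, hb⟩ := exists_sameType_snoc hH (by omega) h a
      exact (ih (by omega) hb).2 (hall b)

theorem le_defDepth_of_hasExtension {V W : Type} [Finite W] {M : ℕ} {G : SimpleGraph V}
    {H : SimpleGraph W} (hG : HasExtension M G) (hH : HasExtension M H)
    (hGH : ¬ Nonempty (G ≃g H)) : ((M + 2 : ℕ) : ℕ∞) ≤ defDepth G := by
  refine le_iInf₂ fun A hA => ?_
  by_contra hlt
  push Not at hlt
  have hlt' : quantDepth A < M + 2 := by exact_mod_cast hlt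
  refine hA.2 W H hGH ?_
  exact (realize_iff_of_sameType hG hH _ _ A (by omega) (fun i => i.elim0)).1 hA.1

theorem defDepth_le_defDepthAlt {V : Type} (r : ℕ) (G : SimpleGraph V) :
    defDepth G ≤ defDepthAlt r G :=
  le_iInf₂ fun A hA => iInf₂_le A hA.1

end Logic

/-! ### Expectation and independence for uniform bit strings -/

section Average

variable {E : Type} [Fintype E] [DecidableEq E]

/-- The expectation of `F` for a uniformly random bit string indexed by `E`. -/
noncomputable def avg (F : (E → Bool) → ℝ) : ℝ := (∑ f, F f) / 2 ^ Fintype.card E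

open Classical in
/-- The indicator function of a proposition. -/
noncomputable def ind (p : Prop) : ℝ := if p then 1 else 0

theorem ind_of_true {p : Prop} (h : p) : ind p = 1 := if_pos h

theorem ind_of_false {p : Prop} (h : ¬ p) : ind p = 0 := if_neg h

theorem ind_nonneg (p : Prop) : 0 ≤ ind p := by
  unfold ind; split_ifs <;> norm_num

theorem ind_le_one (p : Prop) : ind p ≤ 1 := by
  unfold ind; split_ifs <;> norm_num

theorem ind_mono {p q : Prop} (h : p → q) : ind p ≤ ind q := by
  by_cases hp : p
  · rw [ind_of_true hp, ind_of_true (h hp)]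
  · rw [ind_of_false hp]; exact ind_nonneg q

theorem ind_and (p q : Prop) : ind (p ∧ q) = ind p * ind q := by
  by_cases hp : p <;> by_cases hq : q <;> simp [ind, hp, hq]

theorem ind_not (p : Prop) : ind (¬ p) = 1 - ind p := by
  by_cases hp : p <;> simp [ind, hp]

theorem ind_congr {p q : Prop} (h : p ↔ q) : ind p = ind q := by rw [propext h]

theorem ind_forall {ι : Type} (s : Finset ι) (p : ι → Prop) :
    ind (∀ i ∈ s, p i) = ∏ i ∈ s, ind (p i) := by
  classical
  induction s using Finset.induction_on with
  | empty => simp [ind]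
  | insert a s ha ih => rw [Finset.prod_insert ha, ← ih, ← ind_and, Finset.forall_mem_insert]

theorem ind_exists_le {ι : Type} (s : Finset ι) (p : ι → Prop) :
    ind (∃ i ∈ s, p i) ≤ ∑ i ∈ s, ind (p i) := by
  by_cases h : ∃ i ∈ s, p i
  · obtain ⟨i, hi, hp⟩ := h
    rw [ind_of_true ⟨i, hi, hp⟩]
    calc (1 : ℝ) = ind (p i) := (ind_of_true hp).symm
      _ ≤ _ := Finset.single_le_sum (f := fun i => ind (p i)) (fun i _ => ind_nonneg _) hi
  · rw [ind_of_false h]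
    exact Finset.sum_nonneg fun i _ => ind_nonneg _

theorem sum_ind_eq_card {ι : Type} [Fintype ι] (p : ι → Prop) [DecidablePred p] :
    ∑ i, ind (p i) = (Finset.univ.filter p).card := by
  rw [Finset.card_filter]
  push_cast
  exact Finset.sum_congr rfl fun i _ => by by_cases h : p i <;> simp [ind, h]

theorem avg_mono {F G : (E → Bool) → ℝ} (h : ∀ f, F f ≤ G f) : avg F ≤ avg G := by
  unfold avg
  gcongr with f
  exact h f

theorem avg_const (c : ℝ) : avg (fun _ : E → Bool => c) = c := by
  simp [avg]

theorem avg_nonneg {F : (E → Bool) → ℝ} (h : ∀ f, 0 ≤ F f) : 0 ≤ avg F :=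
  (avg_const (E := E) 0).symm.le.trans (avg_mono h)

theorem avg_add (F G : (E → Bool) → ℝ) : avg (fun f => F f + G f) = avg F + avg G := by
  simp [avg, Finset.sum_add_distrib, add_div]

theorem avg_sub (F G : (E → Bool) → ℝ) : avg (fun f => F f - G f) = avg F - avg G := by
  simp [avg, Finset.sum_sub_distrib, sub_div]

theorem avg_const_mul (c : ℝ) (F : (E → Bool) → ℝ) : avg (fun f => c * F f) = c * avg F := by
  simp [avg, ← Finset.mul_sum, mul_div_assoc]

theorem avg_mul_const (c : ℝ) (F : (E → Bool) → ℝ) : avg (fun f => F f * c) = avg F * c := by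
  simp_rw [mul_comm _ c]
  exact avg_const_mul c F

theorem avg_sum {ι : Type} (s : Finset ι) (F : ι → (E → Bool) → ℝ) :
    avg (fun f => ∑ i ∈ s, F i f) = ∑ i ∈ s, avg (F i) := by
  unfold avg
  rw [Finset.sum_comm, Finset.sum_div]

/-- Resampling the coordinates in `S` does not change the expectation. -/
theorem avg_eq_avg_piecewise (S : Set E) [DecidablePred (· ∈ S)] (K : (E → Bool) → ℝ) :
    avg K = avg fun g => avg fun f => K (S.piecewise f g) := by
  -- Exchanging the `S`-coordinates of two independent strings is an involution, hence preserves the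
  -- uniform measure on pairs.
  have hinv : Function.Involutive fun p : (E → Bool) × (E → Bool) =>
      (S.piecewise p.1 p.2, S.piecewise p.2 p.1) := by
    rintro ⟨f, g⟩
    ext e <;> by_cases he : e ∈ S <;> simp [he]
  have h₁ : ∑ p : (E → Bool) × (E → Bool), K (S.piecewise p.1 p.2) =
      ∑ p : (E → Bool) × (E → Bool), K p.1 :=
    Equiv.sum_comp (hinv.toPerm _) (fun p : (E → Bool) × (E → Bool) => K p.1)
  rw [Fintype.sum_prod_type_right, Fintype.sum_prod_type_right] at h₁
  simp only [avg]
  rw [← Finset.sum_div, h₁]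
  simp

theorem avg_mul_of_dependsOn {F G : (E → Bool) → ℝ} {S T : Set E} (hF : DependsOn F S)
    (hG : DependsOn G T) (hST : Disjoint S T) : avg (fun f => F f * G f) = avg F * avg G := by
  classical
  rw [avg_eq_avg_piecewise S]
  have : ∀ f g : E → Bool, F (S.piecewise f g) * G (S.piecewise f g) = F f * G g := by
    intro f g
    congr 1
    · exact hF fun e he => by simp [he]
    · exact hG fun e he => by simp [Set.disjoint_right.1 hST he]
  simp_rw [this, avg_mul_const, avg_const_mul]

theorem dependsOn_finset_prod {E ι : Type} {s : Finset ι} {F : ι → (E → Bool) → ℝ} {D : ι → Set E}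
    (h : ∀ i ∈ s, DependsOn (F i) (D i)) :
    DependsOn (fun f => ∏ i ∈ s, F i f) (⋃ i ∈ s, D i) := by
  intro f g hfg
  refine Finset.prod_congr rfl fun i hi => h i hi fun e he => hfg e ?_
  exact Set.mem_biUnion (by exact_mod_cast hi) he

theorem avg_mul_prod_of_dependsOn {ι : Type} {s : Finset ι} {K : (E → Bool) → ℝ} {C : Set E}
    {F : ι → (E → Bool) → ℝ} {D : ι → Set E} (hK : DependsOn K C)
    (hF : ∀ i ∈ s, DependsOn (F i) (D i)) (hC : ∀ i ∈ s, Disjoint C (D i))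
    (hD : ∀ i ∈ s, ∀ j ∈ s, i ≠ j → Disjoint (D i) (D j)) :
    avg (fun f => K f * ∏ i ∈ s, F i f) = avg K * ∏ i ∈ s, avg (F i) := by
  classical
  induction s using Finset.induction_on with
  | empty => simp
  | insert a s ha ih =>
    have h₁ : DependsOn (fun f => K f * ∏ i ∈ s, F i f) (C ∪ ⋃ i ∈ s, D i) := by
      intro f g hfg
      have h₂ := dependsOn_finset_prod (fun i hi => hF i (Finset.mem_insert_of_mem hi))
        (fun e he => hfg e (Or.inr he))
      simp only at h₂ ⊢
      rw [h₂, hK fun e he => hfg e (Or.inl he)]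
    have h₂ := avg_mul_of_dependsOn h₁ (hF a (Finset.mem_insert_self _ _)) (by
      rw [Set.disjoint_union_left]
      refine ⟨hC a (Finset.mem_insert_self _ _), ?_⟩
      simp only [Set.disjoint_iUnion_left]
      intro i hi
      exact hD _ (Finset.mem_insert_of_mem hi) _ (Finset.mem_insert_self _ _)
        (fun h => ha (h ▸ hi)))
    rw [Finset.prod_insert ha, mul_left_comm, mul_comm, ← ih
      (fun i hi => hF i (Finset.mem_insert_of_mem hi))
      (fun i hi => hC i (Finset.mem_insert_of_mem hi))
      (fun i hi j hj => hD i (Finset.mem_insert_of_mem hi) j (Finset.mem_insert_of_mem hj)), ← h₂]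
    congr 1
    funext f
    rw [Finset.prod_insert ha]
    ring

theorem avg_ind_apply_eq (e : E) (c : Bool) : avg (fun f => ind (f e = c)) = 1 / 2 := by
  have hinv : Function.Involutive fun f : E → Bool => Function.update f e (!f e) := by
    intro f
    simp
  have h₁ : ∑ f : E → Bool, ind (¬ f e = c) = ∑ f : E → Bool, ind (f e = c) := by
    rw [← Equiv.sum_comp (hinv.toPerm _)]
    refine Finset.sum_congr rfl fun f _ => ind_congr ?_
    simp
  have h₂ : avg (fun f => ind (f e = c)) + avg (fun f => ind (f e = c)) = 1 := by
    rw [← avg_const (E := E) 1]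
    nth_rw 2 [avg]
    rw [← h₁, ← avg, ← avg_add]
    congr 1
    funext f
    rw [ind_not]
    ring
  linarith

theorem avg_ind_forall_eq {ι : Type} {s : Finset ι} {g : ι → E} (hg : Set.InjOn g s)
    (b : ι → Bool) : avg (fun f => ind (∀ i ∈ s, f (g i) = b i)) = (1 / 2) ^ s.card := by
  have := avg_mul_prod_of_dependsOn (s := s) (K := fun _ => (1 : ℝ)) (C := ∅)
    (F := fun i f => ind (f (g i) = b i)) (D := fun i => {g i}) (dependsOn_const 1)
    (fun i _ f f' h => by simp only [h (g i) rfl]) (by simp)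
    (fun i hi j hj hij => by simpa using fun h => hij (hg hi hj h))
  simp only [one_mul, avg_const, avg_ind_apply_eq, Finset.prod_const] at this
  simp_rw [ind_forall]
  exact this

/-- Conditionally on the coordinates outside `g '' s`, both the target bits and `K` are constants,
while the bits `f (g i)` remain uniform. -/
theorem avg_mul_ind_forall_eq {ι : Type} {s : Finset ι} {g : ι → E} (hg : Set.InjOn g s)
    {K : (E → Bool) → ℝ} {b : (E → Bool) → ι → Bool} (hK : DependsOn K (g '' s)ᶜ)
    (hb : ∀ i ∈ s, DependsOn (fun f => b f i) (g '' s)ᶜ) :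
    avg (fun f => K f * ind (∀ i ∈ s, f (g i) = b f i)) = avg K * (1 / 2) ^ s.card := by
  classical
  rw [avg_eq_avg_piecewise (g '' s)]
  have : ∀ f f' : E → Bool, K ((g '' s).piecewise f f') * ind (∀ i ∈ s,
      (g '' s).piecewise f f' (g i) = b ((g '' s).piecewise f f') i) =
        K f' * ind (∀ i ∈ s, f (g i) = b f' i) := by
    intro f f'
    have h : ∀ e ∈ (g '' s)ᶜ, (g '' s).piecewise f f' e = f' e :=
      fun e he => Set.piecewise_eq_of_notMem _ _ _ he
    congr 1
    · exact hK h
    · refine ind_congr (forall₂_congr fun i hi => ?_)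
      have := hb i hi h
      simp only at this
      rw [this, Set.piecewise_eq_of_mem _ _ _ (Set.mem_image_of_mem g hi)]
  simp_rw [this, avg_const_mul, avg_ind_forall_eq hg, avg_mul_const]

theorem avg_ind_le_of_markov {Y : (E → Bool) → ℝ} (hY : ∀ f, 0 ≤ Y f) {a : ℝ} (ha : 0 < a) :
    avg (fun f => ind (a ≤ Y f)) ≤ avg Y / a := by
  rw [le_div_iff₀ ha, ← avg_mul_const]
  refine avg_mono fun f => ?_
  by_cases h : a ≤ Y f
  · rw [ind_of_true h]; linarith
  · rw [ind_of_false h]; simpa using hY f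

theorem avg_ind_le_of_chebyshev {Y : (E → Bool) → ℝ} (hY : 0 < avg Y) :
    avg (fun f => ind (Y f ≤ avg Y / 2)) ≤ 4 * (avg (fun f => Y f ^ 2) / avg Y ^ 2 - 1) := by
  set μ := avg Y with hμ
  have h₁ : avg (fun f => (Y f - μ) ^ 2) = avg (fun f => Y f ^ 2) - μ ^ 2 := by
    have : (fun f => (Y f - μ) ^ 2) = fun f => (Y f ^ 2 - 2 * μ * Y f) + μ ^ 2 := by
      funext f; ring
    rw [this, avg_add, avg_sub, avg_const_mul, avg_const, ← hμ]
    ring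
  have h₂ : avg (fun f => ind (Y f ≤ μ / 2)) ≤ avg (fun f => (Y f - μ) ^ 2) / (μ / 2) ^ 2 := by
    refine le_trans (avg_mono fun f => ?_)
      (avg_ind_le_of_markov (fun f => sq_nonneg (Y f - μ)) (by positivity))
    exact ind_mono fun h => by nlinarith
  refine h₂.trans (le_of_eq ?_)
  rw [h₁]
  field_simp
  norm_num

end Average

/-! ### The random graph as a uniform bit string on unordered pairs; diagonal bits are ignored -/

section RandomGraph

variable {V : Type}

/-- The graph whose edges are the pairs `e` with `f e = true`. -/
def graphOf (f : Sym2 V → Bool) : SimpleGraph V := SimpleGraph.fromEdgeSet {e | f e = true}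

theorem graphOf_adj (f : Sym2 V → Bool) (u v : V) :
    (graphOf f).Adj u v ↔ f s(u, v) = true ∧ u ≠ v := by
  simp [graphOf]

variable [Fintype V] [DecidableEq V]

theorem binomialRandom_half_real_singleton (G : SimpleGraph V) :
    (SimpleGraph.binomialRandom V half).real {G} = (1 / 2) ^ (Fintype.card V).choose 2 := by
  have hle : G.edgeSet.ncard ≤ (Nat.card V).choose 2 := by
    classical
    rw [Nat.card_eq_fintype_card, ← Sym2.card_diagSet_compl, Fintype.card_eq_nat_card,
      Nat.card_coe_set_eq]
    exact Set.ncard_le_ncard G.edgeSet_subset_compl_diagSet (Set.toFinite _)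
  have h₁ : (unitInterval.toNNReal half : ℝ) = 1 / 2 := rfl
  have h₂ : (unitInterval.toNNReal (unitInterval.symm half) : ℝ) = 1 / 2 := by
    change (1 : ℝ) - 1 / 2 = 1 / 2
    norm_num
  rw [MeasureTheory.Measure.real, SimpleGraph.binomialRandom_singleton]
  simp only [ENNReal.toReal_mul, ENNReal.toReal_pow, ENNReal.coe_toReal, h₁, h₂]
  rw [← pow_add, Nat.add_sub_cancel' hle, Nat.card_eq_fintype_card]

theorem avg_ind_graphOf_eq (G : SimpleGraph V) :
    avg (fun f => ind (graphOf f = G)) = (1 / 2) ^ (Fintype.card V).choose 2 := by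
  classical
  have := avg_ind_forall_eq (s := Finset.univ.filter fun e : Sym2 V => ¬ e.IsDiag)
    (Set.injOn_id _) (fun e => decide (e ∈ G.edgeSet))
  simp only [id_eq] at this
  have hc : (Finset.univ.filter fun e : Sym2 V => ¬ e.IsDiag).card =
      (Fintype.card V).choose 2 := by
    rw [← Fintype.card_subtype, Sym2.card_subtype_not_diag]
  rw [hc] at this
  rw [← this]
  congr 1
  funext f
  refine ind_congr ?_
  simp only [Finset.mem_filter, Finset.mem_univ, true_and]
  constructor
  · rintro rfl e he
    induction e with
    | _ u v =>
      simp only [Sym2.mk_isDiag_iff] at he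
      rw [Bool.eq_iff_iff]
      simp [graphOf_adj, he]
  · intro h
    ext u v
    rw [graphOf_adj]
    constructor
    · rintro ⟨h₁, h₂⟩
      rw [h _ (by simpa using h₂)] at h₁
      simpa using h₁
    · intro hG
      exact ⟨by rw [h _ (by simpa using hG.ne)]; simpa using hG, hG.ne⟩

theorem prob_eq_avg (n : ℕ) (P : SimpleGraph (Fin n) → Prop) :
    prob n P = avg (fun f : Sym2 (Fin n) → Bool => ind (P (graphOf f))) := by
  classical
  have h₁ : prob n P = ∑ G ∈ Finset.univ.filter P,
      (SimpleGraph.binomialRandom (Fin n) half).real {G} := by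
    have : MeasurableSingletonClass (SimpleGraph (Fin n)) := by
      refine ⟨fun G => ?_⟩
      have hG : ({G} : Set (SimpleGraph (Fin n))) = SimpleGraph.Adj ⁻¹' {G.Adj} := by
        ext H
        simp
      rw [hG]
      exact SimpleGraph.measurable_adj (measurableSet_singleton _)
    rw [MeasureTheory.sum_measureReal_singleton, prob]
    congr 1
    ext G
    simp
  rw [h₁]
  have h₂ : ∀ f : Sym2 (Fin n) → Bool, ind (P (graphOf f)) =
      ∑ G ∈ Finset.univ.filter P, ind (graphOf f = G) := by
    intro f
    simp [ind, Finset.sum_ite_eq]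
  simp_rw [h₂, avg_sum]
  refine Finset.sum_congr rfl fun G _ => ?_
  rw [binomialRandom_half_real_singleton, avg_ind_graphOf_eq]

end RandomGraph

/-! ### Probabilities of extension, isolation and coincidence -/

section Stars

variable {V : Type}

/-- The pairs joining `z` to the set `S`. -/
def star (z : V) (S : Finset V) : Set (Sym2 V) := (fun x => s(z, x)) '' S

theorem star_mono (z : V) {S T : Finset V} (h : S ⊆ T) : star z S ⊆ star z T :=
  Set.image_mono (by exact_mod_cast h)

theorem disjoint_star {z z' : V} {S : Finset V} (hz : z ∉ S) (h : z ≠ z') :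
    Disjoint (star z S) (star z' S) := by
  rw [Set.disjoint_left]
  rintro _ ⟨x, hx, rfl⟩ ⟨y, hy, hxy⟩
  simp only [Sym2.eq_iff] at hxy
  rcases hxy with ⟨h₁, -⟩ | ⟨-, h₁⟩
  · exact h h₁.symm
  · exact hz (h₁ ▸ hy)

theorem dependsOn_star (z : V) (S : Finset V) (b : V → Bool) :
    DependsOn (fun f : Sym2 V → Bool => ∀ x ∈ S, f s(z, x) = b x) (star z S) := by
  intro f g h
  refine propext (forall₂_congr fun x hx => ?_)
  rw [h _ ⟨x, hx, rfl⟩]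

variable [Fintype V] [DecidableEq V]

theorem avg_ind_star (z : V) (S : Finset V) (b : V → Bool) :
    avg (fun f : Sym2 V → Bool => ind (∀ x ∈ S, f s(z, x) = b x)) = (1 / 2) ^ S.card :=
  avg_ind_forall_eq (fun _ _ _ _ h => Sym2.congr_right.1 h) b

/-- The events `R z`, for `z` in a set disjoint from `S`, are independent if `R z` depends only on
the pairs joining `z` to `S`. -/
theorem avg_mul_ind_forall_star {S Z : Finset V} (hSZ : Disjoint S Z)
    {K : (Sym2 V → Bool) → ℝ} {C : Set (Sym2 V)} (hK : DependsOn K C)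
    (hC : ∀ z ∈ Z, Disjoint C (star z S)) {R : V → (Sym2 V → Bool) → Prop}
    (hR : ∀ z ∈ Z, DependsOn (R z) (star z S)) {r : ℝ}
    (hr : ∀ z ∈ Z, avg (fun f => ind (R z f)) = r) :
    avg (fun f => K f * ind (∀ z ∈ Z, R z f)) = avg K * r ^ Z.card := by
  have := avg_mul_prod_of_dependsOn (s := Z) (F := fun z f => ind (R z f))
    (D := fun z => star z S) hK (fun z hz f g h => by simp only [hR z hz h]) hC
    (fun z hz z' _ h => disjoint_star (Finset.disjoint_right.1 hSZ hz) h)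
  simp_rw [ind_forall, this]
  rw [Finset.prod_congr rfl hr, Finset.prod_const]

theorem avg_ind_not_star (z : V) (S : Finset V) (b : V → Bool) :
    avg (fun f : Sym2 V → Bool => ind (¬ ∀ x ∈ S, f s(z, x) = b x)) = 1 - (1 / 2) ^ S.card := by
  simp_rw [ind_not, avg_sub, avg_const, avg_ind_star]

theorem avg_ind_not_star_and_not_star (z : V) (S T : Finset V) (b : V → Bool) :
    avg (fun f : Sym2 V → Bool =>
      ind ((¬ ∀ x ∈ S, f s(z, x) = b x) ∧ ¬ ∀ x ∈ T, f s(z, x) = b x)) =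
        1 - (1 / 2) ^ S.card - (1 / 2) ^ T.card + (1 / 2) ^ (S ∪ T).card := by
  rw [← avg_ind_star z S b, ← avg_ind_star z T b, ← avg_ind_star z (S ∪ T) b,
    ← avg_const (E := Sym2 V) 1, ← avg_sub, ← avg_sub, ← avg_add]
  congr 1
  funext f
  have : (∀ x ∈ S ∪ T, f s(z, x) = b x) ↔
      (∀ x ∈ S, f s(z, x) = b x) ∧ ∀ x ∈ T, f s(z, x) = b x := by
    simp only [Finset.mem_union, or_imp, forall_and]
  rw [ind_congr this, ind_and, ind_and, ind_not, ind_not]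
  ring

theorem avg_ind_forall_not_star (S : Finset V) (b : V → Bool) :
    avg (fun f : Sym2 V → Bool => ind (∀ z ∈ Sᶜ, ¬ ∀ x ∈ S, f s(z, x) = b x)) =
      (1 - (1 / 2) ^ S.card) ^ (Fintype.card V - S.card) := by
  have := avg_mul_ind_forall_star (S := S) (Z := Sᶜ) disjoint_compl_right
    (K := fun _ => 1) (C := ∅) (dependsOn_const 1) (by simp)
    (R := fun z f => ¬ ∀ x ∈ S, f s(z, x) = b x)
    (fun z _ f g h => by simp only [dependsOn_star z S b h]) (fun z _ => avg_ind_not_star z S b)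
  simpa [avg_const, Finset.card_compl] using this

/-- Union bound over sets of size exactly `M` and patterns on them: smaller sets can be enlarged,
and vertices outside the set try the pattern independently. -/
theorem avg_ind_not_hasExtension_le {M : ℕ} (hM : M ≤ Fintype.card V) :
    avg (fun f : Sym2 V → Bool => ind (¬ HasExtension M (graphOf f))) ≤
      (2 * Fintype.card V) ^ M * (1 - (1 / 2) ^ M) ^ (Fintype.card V - M) := by
  have h₁ : ∀ f : Sym2 V → Bool, ind (¬ HasExtension M (graphOf f)) ≤
      ∑ S ∈ Finset.univ.powersetCard M, ∑ T ∈ S.powerset,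
        ind (∀ z ∈ Sᶜ, ¬ ∀ x ∈ S, f s(z, x) = decide (x ∈ T)) := by
    intro f
    refine le_trans (ind_mono (q := ∃ S ∈ Finset.univ.powersetCard M, ∃ T ∈ S.powerset,
      ∀ z ∈ Sᶜ, ¬ ∀ x ∈ S, f s(z, x) = decide (x ∈ T)) fun h => ?_)
      ((ind_exists_le _ _).trans (Finset.sum_le_sum fun S _ => ind_exists_le _ _))
    unfold HasExtension at h
    push Not at h
    obtain ⟨S₀, T₀, hS₀, h⟩ := h
    obtain ⟨S, hS, hcard⟩ := Finset.exists_superset_card_eq hS₀ hM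
    refine ⟨S, Finset.mem_powersetCard.2 ⟨Finset.subset_univ _, hcard⟩, T₀ ∩ S,
      Finset.mem_powerset.2 Finset.inter_subset_right, fun z hz hall => ?_⟩
    rw [Finset.mem_compl] at hz
    obtain ⟨x, hx, hx'⟩ := h z fun h => hz (hS h)
    have := hall x (hS hx)
    have hne : z ≠ x := fun h => hz (h ▸ hS hx)
    rw [graphOf_adj, this] at hx'
    simp [hne, hS hx] at hx'
  refine (avg_mono h₁).trans ?_
  simp_rw [avg_sum]
  have h₂ : ∀ S ∈ Finset.univ.powersetCard M, ∑ T ∈ S.powerset, avg (fun f : Sym2 V → Bool =>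
      ind (∀ z ∈ Sᶜ, ¬ ∀ x ∈ S, f s(z, x) = decide (x ∈ T))) =
        2 ^ M * (1 - (1 / 2) ^ M) ^ (Fintype.card V - M) := by
    intro S hS
    rw [Finset.mem_powersetCard] at hS
    rw [Finset.sum_congr rfl fun T _ => avg_ind_forall_not_star S fun x => decide (x ∈ T)]
    simp [hS.2]
  rw [Finset.sum_congr rfl h₂, Finset.sum_const, Finset.card_powersetCard, Finset.card_univ,
    nsmul_eq_mul, mul_pow, mul_comm (2 ^ M : ℝ) (_ ^ M), ← mul_assoc]
  have h₃ : (0 : ℝ) ≤ 1 - (1 / 2) ^ M := by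
    have : ((1 : ℝ) / 2) ^ M ≤ 1 := pow_le_one₀ (by norm_num) (by norm_num)
    linarith
  gcongr
  exact_mod_cast Nat.choose_le_pow (Fintype.card V) M

/-- In the random graph, `w` is joined to all of `S`, and no other vertex outside `S` is. -/
def Isolates (S : Finset V) (w : V) (f : Sym2 V → Bool) : Prop :=
  (∀ x ∈ S, f s(w, x) = true) ∧ ∀ z ∈ (insert w S)ᶜ, ¬ ∀ x ∈ S, f s(z, x) = true

theorem avg_ind_isolates {S : Finset V} {w : V} (hw : w ∉ S) :
    avg (fun f => ind (Isolates S w f)) =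
      (1 / 2) ^ S.card * (1 - (1 / 2) ^ S.card) ^ (Fintype.card V - (S.card + 1)) := by
  have := avg_mul_ind_forall_star (S := S) (Z := (insert w S)ᶜ)
    (Finset.disjoint_left.2 fun x hx => by simp [hx])
    (K := fun f => ind (∀ x ∈ S, f s(w, x) = true)) (C := star w S)
    (fun f g h => by simp only [dependsOn_star w S (fun _ => true) h])
    (fun z hz => disjoint_star hw (by rintro rfl; simp at hz))
    (R := fun z f => ¬ ∀ x ∈ S, f s(z, x) = true)
    (fun z _ f g h => by simp only [dependsOn_star z S (fun _ => true) h])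
    (fun z _ => avg_ind_not_star z S fun _ => true)
  simp only [Isolates, ind_and]
  rw [this, avg_ind_star w S fun _ => true, Finset.card_compl, Finset.card_insert_of_notMem hw]

/-- Only vertices outside `S ∪ T` are tested for avoiding both sets; dropping the others leaves
independent events and can only raise the probability. -/
theorem avg_ind_isolates_mul_le {S T : Finset V} {w : V} (hS : w ∉ S) (hT : w ∉ T) :
    avg (fun f => ind (Isolates S w f) * ind (Isolates T w f)) ≤
      (1 / 2) ^ (S ∪ T).card * (1 - (1 / 2) ^ S.card - (1 / 2) ^ T.card +
        (1 / 2) ^ (S ∪ T).card) ^ (Fintype.card V - ((S ∪ T).card + 1)) := by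
  have hw : w ∉ S ∪ T := by simp [hS, hT]
  have := avg_mul_ind_forall_star (S := S ∪ T) (Z := (insert w (S ∪ T))ᶜ)
    (Finset.disjoint_left.2 fun x hx => by simp only [Finset.mem_compl]; simp [hx])
    (K := fun f => ind (∀ x ∈ S ∪ T, f s(w, x) = true)) (C := star w (S ∪ T))
    (fun f g h => by simp only [dependsOn_star w (S ∪ T) (fun _ => true) h])
    (fun z hz => disjoint_star hw (by rintro rfl; simp at hz))
    (R := fun z f => (¬ ∀ x ∈ S, f s(z, x) = true) ∧ ¬ ∀ x ∈ T, f s(z, x) = true)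
    (fun z _ f g h => by
      simp only [dependsOn_star z S (fun _ => true) fun e he =>
          h e (star_mono z Finset.subset_union_left he),
        dependsOn_star z T (fun _ => true) fun e he =>
          h e (star_mono z Finset.subset_union_right he)])
    (fun z _ => avg_ind_not_star_and_not_star z S T fun _ => true)
  rw [avg_ind_star w (S ∪ T) fun _ => true, Finset.card_compl,
    Finset.card_insert_of_notMem hw] at this
  rw [← this]
  refine avg_mono fun f => ?_
  rw [← ind_and, ← ind_and]
  refine ind_mono ?_
  rintro ⟨⟨h₁, h₂⟩, h₃, h₄⟩
  refine ⟨fun x hx => ?_, fun z hz => ⟨h₂ z ?_, h₄ z ?_⟩⟩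
  · exact (Finset.mem_union.1 hx).elim (h₁ x) (h₃ x)
  all_goals
    simp only [Finset.mem_compl, Finset.mem_insert, Finset.mem_union] at hz ⊢
    tauto

/-- The pairs of distinct indices of which at least one lies outside `J`. -/
def pairsLeaving {k : ℕ} (J : Finset (Fin k)) : Finset (Sym2 (Fin k)) :=
  (Finset.univ.offDiag.image Sym2.mk.uncurry) \ (J.offDiag.image Sym2.mk.uncurry)

theorem mem_pairsLeaving {k : ℕ} {J : Finset (Fin k)} {a b : Fin k} :
    s(a, b) ∈ pairsLeaving J ↔ a ≠ b ∧ ¬ (a ∈ J ∧ b ∈ J) := by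
  have : ∀ I : Finset (Fin k), s(a, b) ∈ I.offDiag.image Sym2.mk.uncurry ↔
      a ∈ I ∧ b ∈ I ∧ a ≠ b := by
    intro I
    simp only [Finset.mem_image, Finset.mem_offDiag, Prod.exists, Function.uncurry_apply_pair]
    constructor
    · rintro ⟨c, d, ⟨h₁, h₂, h₃⟩, h⟩
      rcases Sym2.eq_iff.1 h with ⟨rfl, rfl⟩ | ⟨rfl, rfl⟩
      · exact ⟨h₁, h₂, h₃⟩
      · exact ⟨h₂, h₁, h₃.symm⟩
    · exact fun h => ⟨a, b, h, rfl⟩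
  rw [pairsLeaving, Finset.mem_sdiff, this, this]
  simp
  tauto

theorem card_pairsLeaving {k : ℕ} (J : Finset (Fin k)) :
    (pairsLeaving J).card = k.choose 2 - J.card.choose 2 := by
  rw [pairsLeaving, Finset.card_sdiff_of_subset, Sym2.card_image_offDiag, Sym2.card_image_offDiag,
    Finset.card_univ, Fintype.card_fin]
  exact Finset.image_subset_image (Finset.offDiag_mono (Finset.subset_univ J))

/-- Equality of types forces each pair of `Y` leaving `S` to copy the corresponding pair of `X`. The
pairs of `X` lie inside `S` and the tested stars start outside `S ∪ T`, so these bits of `Y` are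
fresh. -/
theorem avg_ind_coincidence {k : ℕ} {X Y : Fin k → V} (hY : Function.Injective Y)
    {S T Q : Finset V} (hS : S = Finset.univ.image X) (hT : T = Finset.univ.image Y) :
    avg (fun f : Sym2 V → Bool =>
      ind (∀ z ∈ (S ∪ T ∪ Q)ᶜ, (¬ ∀ x ∈ S, f s(z, x) = true) ∧ ¬ ∀ x ∈ T, f s(z, x) = true) *
      ind (∀ p ∈ pairsLeaving (Finset.univ.filter fun a => Y a ∈ S),
        f (Sym2.map Y p) = f (Sym2.map X p))) =
      (1 - (1 / 2) ^ S.card - (1 / 2) ^ T.card + (1 / 2) ^ (S ∪ T).card) ^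
        (Fintype.card V - (S ∪ T ∪ Q).card) *
      (1 / 2) ^ (k.choose 2 - (Finset.univ.filter fun a => Y a ∈ S).card.choose 2) := by
  have hXS : ∀ a, X a ∈ S := fun a => by simp [hS]
  have hYT : ∀ a, Y a ∈ T := fun a => by simp [hT]
  have hR : ∀ z ∈ (S ∪ T ∪ Q)ᶜ, DependsOn (fun f : Sym2 V → Bool =>
      (¬ ∀ x ∈ S, f s(z, x) = true) ∧ ¬ ∀ x ∈ T, f s(z, x) = true) (star z (S ∪ T)) := by
    intro z _ f g h
    simp only [dependsOn_star z S (fun _ => true) fun e he =>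
        h e (star_mono z Finset.subset_union_left he),
      dependsOn_star z T (fun _ => true) fun e he =>
        h e (star_mono z Finset.subset_union_right he)]
  have hst := avg_mul_ind_forall_star (S := S ∪ T) (Z := (S ∪ T ∪ Q)ᶜ)
    (Finset.disjoint_left.2 fun x hx => by
      rw [Finset.mem_compl, not_not]; exact Finset.mem_union_left _ hx)
    (K := fun _ => 1) (C := ∅) (dependsOn_const 1) (by simp) hR
    (fun z _ => avg_ind_not_star_and_not_star z S T fun _ => true)
  simp only [one_mul, avg_const, Finset.card_compl] at hst
  rw [← hst, ← card_pairsLeaving]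
  refine avg_mul_ind_forall_eq (Sym2.map.injective hY).injOn (fun f g h => ?_)
    (fun p _ f g h => ?_)
  · refine ind_congr (forall₂_congr fun z hz => ?_)
    refine iff_of_eq (hR z hz ?_)
    rintro _ ⟨x, hx, rfl⟩
    refine h _ ?_
    rintro ⟨p, -, hp⟩
    have hzp : z ∈ Sym2.map Y p := by rw [hp]; exact Sym2.mem_mk_left z x
    obtain ⟨a, -, rfl⟩ := Sym2.mem_map.1 hzp
    simp [hYT] at hz
  · refine h _ ?_
    rintro ⟨p', hp', hpp⟩
    -- If a leaving pair of `Y` equalled a pair of `X`, both its vertices would lie in `S`,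
    -- contradicting that it leaves.
    have key : ∀ a ∈ p', Y a ∈ S := by
      intro a ha
      have : Y a ∈ Sym2.map X p := by
        rw [← hpp]
        exact Sym2.mem_map.2 ⟨a, ha, rfl⟩
      obtain ⟨b, -, hb⟩ := Sym2.mem_map.1 this
      exact hb ▸ hXS b
    induction p' with
    | _ a b =>
      rw [Finset.mem_coe, mem_pairsLeaving] at hp'
      exact hp'.2 (by simp [key])

end Stars

/-! ### Pinning by the first and second moment methods -/

section Pinned

variable {V : Type} [Fintype V] [DecidableEq V]

theorem isUniqueCommonNbr_of_isolates {k : ℕ} {X : Fin k → V} {w : V}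
    {f : Sym2 V → Bool} (hw : w ∉ Finset.univ.image X)
    (h : Isolates (Finset.univ.image X) w f) :
    IsUniqueCommonNbr (graphOf f) X w := by
  intro z
  constructor
  · intro hz
    by_contra hne
    refine h.2 z ?_ fun x hx => ?_
    · simp only [Finset.mem_compl, Finset.mem_insert, Finset.mem_image, Finset.mem_univ, true_and,
        not_or, not_exists]
      exact ⟨hne, fun i hi => (hz i).ne hi.symm⟩
    · obtain ⟨i, -, rfl⟩ := Finset.mem_image.1 hx
      exact ((graphOf_adj _ _ _).1 (hz i)).1
  · rintro rfl i
    rw [graphOf_adj]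
    exact ⟨h.1 _ (by simp), fun hi => hw (by rw [hi]; simp)⟩

/-- Some vertex other than `w` is the only common neighbour of a tuple of the same atomic type as
`X`. -/
def IsConfused {k : ℕ} (X : Fin k → V) (w : V) (f : Sym2 V → Bool) : Prop :=
  ∃ (Y : Fin k → V) (u : V), u ≠ w ∧ SameType (graphOf f) X (graphOf f) Y ∧
    IsUniqueCommonNbr (graphOf f) Y u

/-- The sum factors over coordinates, and each coordinate contributes at most `k` from `S` plus at
most `1` from the rest. Thus the weight `n⁻¹` per vertex outside `S` pays for the choice of that
vertex. -/
theorem sum_prod_ite_le {k : ℕ} (S : Finset V) (hS : S.card = k) :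
    ∑ Y : Fin k → V, ∏ a, (if Y a ∈ S then 1 else ((Fintype.card V : ℝ))⁻¹) ≤ (k + 1) ^ k := by
  rw [← Fintype.sum_pow (fun v : V => if v ∈ S then 1 else ((Fintype.card V : ℝ))⁻¹)]
  have h₁ : ∑ v : V, (if v ∈ S then 1 else ((Fintype.card V : ℝ))⁻¹) ≤ k + 1 := by
    have h₂ : ∀ v : V, (if v ∈ S then 1 else ((Fintype.card V : ℝ))⁻¹) ≤
        (if v ∈ S then 1 else 0) + ((Fintype.card V : ℝ))⁻¹ := by
      intro v
      split_ifs
      · have : (0 : ℝ) ≤ ((Fintype.card V : ℝ))⁻¹ := by positivity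
        linarith
      · simp
    refine (Finset.sum_le_sum fun v _ => h₂ v).trans ?_
    rw [Finset.sum_add_distrib]
    simp only [Finset.sum_ite_mem, Finset.univ_inter, Finset.sum_const, hS, nsmul_eq_mul, mul_one,
      Finset.card_univ]
    have : (Fintype.card V : ℝ) * (Fintype.card V : ℝ)⁻¹ ≤ 1 := mul_inv_le_one
    linarith
  refine pow_le_pow_left₀ (Finset.sum_nonneg fun v _ => ?_) h₁ k
  split_ifs <;> positivity

theorem avg_ind_isolates_and_isConfused_le {k : ℕ} {X : Fin k → V} (hX : Function.Injective X)
    {w : V} {h : ℝ} (hh : ∀ j, 1 ≤ j → j ≤ k →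
      (1 / 2 : ℝ) ^ (k.choose 2 - (k - j).choose 2) *
        (1 - 2 * (1 / 2) ^ k + (1 / 2) ^ (k + j)) ^ (Fintype.card V - (2 * k + 2)) ≤
          h * (Fintype.card V : ℝ)⁻¹ ^ j) (hh₀ : 0 ≤ h) :
    avg (fun f => ind (Isolates (Finset.univ.image X) w f ∧ IsConfused X w f)) ≤
      Fintype.card V * (h * (k + 1) ^ k) := by
  set S := Finset.univ.image X with hS
  have hScard : S.card = k := by
    rw [hS, Finset.card_image_of_injective _ hX, Finset.card_univ, Fintype.card_fin]
  let I (Y : Fin k → V) (u : V) (f : Sym2 V → Bool) : ℝ :=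
    ind (∀ z ∈ (S ∪ Finset.univ.image Y ∪ {w, u})ᶜ, (¬ ∀ x ∈ S, f s(z, x) = true) ∧
        ¬ ∀ x ∈ Finset.univ.image Y, f s(z, x) = true) *
      ind (∀ p ∈ pairsLeaving (Finset.univ.filter fun a => Y a ∈ S),
        f (Sym2.map Y p) = f (Sym2.map X p))
  let A : Finset (Fin k → V) := Finset.univ.filter fun Y => Function.Injective Y ∧ ∃ a, Y a ∉ S
  have h₁ : ∀ f, ind (Isolates S w f ∧ IsConfused X w f) ≤ ∑ Y ∈ A, ∑ u, I Y u f := by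
    intro f
    simp only [I, ← ind_and]
    refine le_trans (ind_mono ?_)
      ((ind_exists_le _ _).trans (Finset.sum_le_sum fun Y _ => ind_exists_le _ _))
    rintro ⟨hiso, Y, u, hu, hty, hun⟩
    have hYinj : Function.Injective Y := fun a b hab => hX ((hty a b).1.1 hab)
    have huY : ∀ i, (graphOf f).Adj u (Y i) := (hun u).2 rfl
    refine ⟨Y, Finset.mem_filter.2 ⟨Finset.mem_univ _, hYinj, ?_⟩, u, Finset.mem_univ _, ?_, ?_⟩
    -- A rival tuple inside `S` would be a reordering of `X`, making `u` a second common neighbour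
    -- of `S`; so at least one entry leaves `S`.
    · by_contra hall
      push Not at hall
      have hTS : Finset.univ.image Y = S := by
        refine Finset.eq_of_subset_of_card_le (fun x hx => ?_) ?_
        · obtain ⟨i, -, rfl⟩ := Finset.mem_image.1 hx
          exact hall i
        · rw [hScard, Finset.card_image_of_injective _ hYinj, Finset.card_univ, Fintype.card_fin]
      have huS : ∀ x ∈ S, (graphOf f).Adj u x := by
        intro x hx
        rw [← hTS] at hx
        obtain ⟨i, -, rfl⟩ := Finset.mem_image.1 hx
        exact huY i
      refine hiso.2 u ?_ fun x hx => ((graphOf_adj _ _ _).1 (huS x hx)).1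
      simp only [Finset.mem_compl, Finset.mem_insert, not_or]
      exact ⟨hu, fun h => (huS u h).ne rfl⟩
    · intro z hz
      simp only [Finset.mem_compl, Finset.mem_union, Finset.mem_insert, Finset.mem_singleton,
        not_or] at hz
      obtain ⟨⟨hz₁, hz₂⟩, hz₃, hz₄⟩ := hz
      refine ⟨hiso.2 z (by simp [hz₁, hz₃]), fun hall => hz₄ ((hun z).1 fun i => ?_)⟩
      rw [graphOf_adj]
      have hi : Y i ∈ Finset.univ.image Y := by simp
      exact ⟨hall _ hi, fun h => hz₂ (h ▸ hi)⟩
    · intro p hp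
      induction p with
      | _ a b =>
        rw [mem_pairsLeaving] at hp
        have := (hty a b).2
        rw [graphOf_adj, graphOf_adj, and_iff_left (hX.ne hp.1), and_iff_left (hYinj.ne hp.1)]
          at this
        rw [Sym2.map_mk, Sym2.map_mk, Bool.eq_iff_iff]
        exact this
  have h₂ : ∀ Y ∈ A, ∀ u, avg (I Y u) ≤
      h * ∏ a, (if Y a ∈ S then 1 else ((Fintype.card V : ℝ))⁻¹) := by
    intro Y hY u
    obtain ⟨-, hYinj, a₀, ha₀⟩ := Finset.mem_filter.1 hY
    have hTcard : (Finset.univ.image Y).card = k := by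
      rw [Finset.card_image_of_injective _ hYinj, Finset.card_univ, Fintype.card_fin]
    set j := (Finset.univ.filter fun a => Y a ∉ S).card with hj
    have hJ : (Finset.univ.filter fun a => Y a ∈ S).card + j = k := by
      rw [hj, Finset.card_filter_add_card_filter_not]
      simp
    have hj₁ : 1 ≤ j := Finset.card_pos.2 ⟨a₀, by simp [ha₀]⟩
    have hST : (S ∪ Finset.univ.image Y).card = k + j := by
      have : S ∪ Finset.univ.image Y = S ∪ (Finset.univ.filter fun a => Y a ∉ S).image Y := by
        ext x
        simp only [Finset.mem_union, Finset.mem_image, Finset.mem_univ, true_and,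
          Finset.mem_filter]
        constructor
        · rintro (hx | ⟨a, rfl⟩)
          · exact Or.inl hx
          · by_cases ha : Y a ∈ S
            · exact Or.inl ha
            · exact Or.inr ⟨a, ha, rfl⟩
        · rintro (hx | ⟨a, -, rfl⟩)
          · exact Or.inl hx
          · exact Or.inr ⟨a, rfl⟩
      rw [this, Finset.card_union_of_disjoint, Finset.card_image_of_injective _ hYinj, hScard]
      rw [Finset.disjoint_left]
      rintro x hx hx'
      obtain ⟨a, ha, rfl⟩ := Finset.mem_image.1 hx'
      exact (Finset.mem_filter.1 ha).2 hx
    have hprod : ∏ a, (if Y a ∈ S then 1 else ((Fintype.card V : ℝ))⁻¹) =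
        (Fintype.card V : ℝ)⁻¹ ^ j := by
      rw [Finset.prod_ite]
      simp [hj]
    rw [hprod]
    refine le_trans (le_of_eq (avg_ind_coincidence (Q := {w, u}) hYinj hS rfl)) ?_
    refine le_trans ?_ (hh j hj₁ (by omega))
    rw [hScard, hTcard, hST, show (Finset.univ.filter fun a => Y a ∈ S).card = k - j by omega,
      mul_comm]
    have hq : ((1 : ℝ) / 2) ^ (k + j) ≤ (1 / 2) ^ k :=
      pow_le_pow_of_le_one (by norm_num) (by norm_num) (by omega)
    have hq' : ((1 : ℝ) / 2) ^ k ≤ (1 / 2) ^ 1 :=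
      pow_le_pow_of_le_one (by norm_num) (by norm_num) (by omega)
    have hq₀ : (0 : ℝ) ≤ (1 / 2) ^ k := by positivity
    have hq₁ : (0 : ℝ) ≤ (1 / 2) ^ (k + j) := by positivity
    have hbase : (1 : ℝ) - (1 / 2) ^ k - (1 / 2) ^ k + (1 / 2) ^ (k + j) =
      1 - 2 * (1 / 2) ^ k + (1 / 2) ^ (k + j) := by ring
    rw [hbase]
    refine mul_le_mul_of_nonneg_left ?_ (by positivity)
    refine pow_le_pow_of_le_one (by linarith) (by linarith) ?_
    have : (S ∪ Finset.univ.image Y ∪ {w, u}).card ≤ (k + j) + 2 :=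
      (Finset.card_union_le _ _).trans (by rw [hST]; exact Nat.add_le_add_left Finset.card_le_two _)
    omega
  refine (avg_mono h₁).trans ?_
  simp_rw [avg_sum]
  calc ∑ Y ∈ A, ∑ u, avg (I Y u)
      ≤ ∑ Y ∈ A, ∑ u : V, h * ∏ a, (if Y a ∈ S then 1 else ((Fintype.card V : ℝ))⁻¹) :=
        Finset.sum_le_sum fun Y hY => Finset.sum_le_sum fun u _ => h₂ Y hY u
    _ = Fintype.card V * (h * ∑ Y ∈ A,
          ∏ a, (if Y a ∈ S then 1 else ((Fintype.card V : ℝ))⁻¹)) := by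
        simp only [Finset.sum_const, Finset.card_univ, nsmul_eq_mul, ← Finset.mul_sum]
    _ ≤ _ := by
        gcongr
        refine le_trans (Finset.sum_le_sum_of_subset_of_nonneg (Finset.subset_univ _)
          fun Y _ _ => Finset.prod_nonneg fun a _ => ?_) (sum_prod_ite_le S hScard)
        split_ifs <;> positivity

/-- The number of places where two functions agree. -/
def agreement {k N : ℕ} (σ τ : Fin k → Fin N) : ℕ := (Finset.univ.filter fun i => σ i = τ i).card

/-- Each coordinate is summed separately: one value agrees with `σ` and contributes `B`, the other
`N - 1` contribute `1`. -/
theorem sum_pow_agreement {k N : ℕ} (hN : 0 < N) (σ : Fin k → Fin N) (B : ℝ) :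
    ∑ τ : Fin k → Fin N, B ^ agreement σ τ = (N - 1 + B) ^ k := by
  have h₁ : ∀ τ : Fin k → Fin N, B ^ agreement σ τ = ∏ i, if σ i = τ i then B else 1 := by
    intro τ
    rw [Finset.prod_ite]
    simp [agreement]
  simp_rw [h₁]
  have h₂ := (Finset.prod_univ_sum (fun _ : Fin k => (Finset.univ : Finset (Fin N)))
    (fun i x => if σ i = x then B else 1)).symm
  rw [Fintype.piFinset_univ] at h₂
  rw [h₂]
  have h₃ : ∀ i, ∑ x : Fin N, (if σ i = x then B else 1) = N - 1 + B := by
    intro i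
    rw [← Finset.add_sum_erase _ _ (Finset.mem_univ (σ i)), if_pos rfl,
      Finset.sum_congr rfl fun x hx => if_neg (Finset.ne_of_mem_erase hx).symm]
    simp [Finset.card_erase_of_mem, Nat.cast_sub (Nat.succ_le_of_lt hN)]
    ring
  simp [h₃]

/-- Failure means that either few transversals isolate `w` (Chebyshev) or at least half the expected
number isolate it but are confused (Markov). Transversals of disjoint blocks make every tuple
injective and reduce the overlap of two tuples to coordinatewise agreement, so the second moment is
a product. -/
theorem avg_ind_not_isPinned_le {k N : ℕ} (hN : 0 < N) (w : V)
    (ι : Fin k × Fin N ↪ V) (hι : ∀ p, ι p ≠ w) {p A B c : ℝ}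
    (hp : p = (1 / 2) ^ k * (1 - (1 / 2) ^ k) ^ (Fintype.card V - (k + 1))) (hp₀ : 0 < p)
    (hAB : ∀ s ≤ k, (1 / 2 : ℝ) ^ (2 * k - s) * (1 - 2 * (1 / 2) ^ k + (1 / 2) ^ (2 * k - s)) ^
      (Fintype.card V - (2 * k - s + 1)) ≤ p ^ 2 * (A * B ^ s))
    (hc : ∀ X : Fin k → V, Function.Injective X →
      avg (fun f => ind (Isolates (Finset.univ.image X) w f ∧ IsConfused X w f)) ≤ c) :
    avg (fun f => ind (¬ IsPinned k (graphOf f) w)) ≤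
      4 * (A * ((N - 1 + B) / N) ^ k - 1) + 2 * (c / p) := by
  have hNR : (0 : ℝ) < N := by exact_mod_cast hN
  let X (σ : Fin k → Fin N) (i : Fin k) : V := ι (i, σ i)
  have hX : ∀ σ, Function.Injective (X σ) := fun σ i j hij => by
    have := ι.injective hij
    exact (Prod.ext_iff.1 this).1
  let S (σ : Fin k → Fin N) : Finset V := Finset.univ.image (X σ)
  have hScard : ∀ σ, (S σ).card = k := fun σ => by
    rw [Finset.card_image_of_injective _ (hX σ), Finset.card_univ, Fintype.card_fin]
  have hwS : ∀ σ, w ∉ S σ := fun σ => by simp [S, X, hι]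
  have hunion : ∀ σ τ, (S σ ∪ S τ).card = 2 * k - agreement σ τ := by
    intro σ τ
    have hinter : S σ ∩ S τ = (Finset.univ.filter fun i => σ i = τ i).image (X σ) := by
      ext x
      simp only [S, Finset.mem_inter, Finset.mem_image, Finset.mem_univ, true_and,
        Finset.mem_filter]
      constructor
      · rintro ⟨⟨i, rfl⟩, j, hj⟩
        have h := Prod.ext_iff.1 (ι.injective hj)
        simp only at h
        obtain ⟨rfl, h⟩ := h
        exact ⟨j, h.symm, rfl⟩
      · rintro ⟨i, hi, rfl⟩
        exact ⟨⟨i, rfl⟩, i, by simp [X, hi]⟩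
    have h₁ := Finset.card_union_add_card_inter (S σ) (S τ)
    rw [hinter, Finset.card_image_of_injective _ (hX σ), hScard, hScard] at h₁
    unfold agreement
    omega
  let Y (f : Sym2 V → Bool) : ℝ := ∑ σ, ind (Isolates (S σ) w f)
  let Y' (f : Sym2 V → Bool) : ℝ := ∑ σ, ind (Isolates (S σ) w f ∧ IsConfused (X σ) w f)
  have hYavg : avg Y = N ^ k * p := by
    simp only [Y, avg_sum]
    rw [Finset.sum_congr rfl fun σ _ => (avg_ind_isolates (hwS σ)).trans (by rw [hScard, ← hp])]
    simp
  have hY'avg : avg Y' ≤ N ^ k * c := by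
    simp only [Y', avg_sum]
    refine (Finset.sum_le_sum fun σ _ => hc (X σ) (hX σ)).trans (le_of_eq ?_)
    simp
  have hYsq : avg (fun f => Y f ^ 2) ≤ N ^ k * (p ^ 2 * (A * (N - 1 + B) ^ k)) := by
    simp only [Y, pow_two, Finset.sum_mul_sum, avg_sum]
    have h₁ : ∀ σ τ, avg (fun f => ind (Isolates (S σ) w f) * ind (Isolates (S τ) w f)) ≤
        p ^ 2 * (A * B ^ agreement σ τ) := by
      intro σ τ
      refine (avg_ind_isolates_mul_le (hwS σ) (hwS τ)).trans ?_
      rw [hunion, hScard, hScard]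
      refine le_trans (le_of_eq ?_) (hAB (agreement σ τ) ?_)
      · congr 2
        ring
      · exact (Finset.card_le_univ _).trans (by simp)
    refine (Finset.sum_le_sum fun σ _ => Finset.sum_le_sum fun τ _ => h₁ σ τ).trans
      (le_of_eq ?_)
    simp_rw [← Finset.mul_sum, sum_pow_agreement hN]
    simp [pow_two]
    ring
  have hμ : 0 < avg Y := by rw [hYavg]; positivity
  have h₁ : ∀ f, ind (¬ IsPinned k (graphOf f) w) ≤
      ind (Y f ≤ avg Y / 2) + ind (avg Y / 2 ≤ Y' f) := by
    intro f
    by_cases hpin : IsPinned k (graphOf f) w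
    · rw [ind_of_false (not_not.2 hpin)]
      exact add_nonneg (ind_nonneg _) (ind_nonneg _)
    have hle : Y f ≤ Y' f := by
      refine Finset.sum_le_sum fun σ _ => ind_mono fun hiso => ⟨hiso, ?_⟩
      by_contra hcon
      refine hpin ⟨X σ, isUniqueCommonNbr_of_isolates (hwS σ) hiso, fun Z y hZ hy => ?_⟩
      by_contra hne
      exact hcon ⟨Z, y, hne, hZ, hy⟩
    rcases le_total (Y f) (avg Y / 2) with h | h
    · rw [ind_of_true h]
      have := ind_nonneg (avg Y / 2 ≤ Y' f)
      exact (ind_le_one _).trans (by linarith)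
    · rw [ind_of_true (h.trans hle)]
      have := ind_nonneg (Y f ≤ avg Y / 2)
      exact (ind_le_one _).trans (by linarith)
  refine (avg_mono h₁).trans ?_
  rw [avg_add]
  refine add_le_add ((avg_ind_le_of_chebyshev hμ).trans ?_)
    ((avg_ind_le_of_markov (fun f => Finset.sum_nonneg fun σ _ => ind_nonneg _)
      (by positivity)).trans ?_)
  · gcongr
    rw [hYavg, div_le_iff₀ (by positivity)]
    refine hYsq.trans (le_of_eq ?_)
    rw [div_pow]
    field_simp
  · rw [hYavg, div_le_iff₀ (by positivity)]
    refine hY'avg.trans (le_of_eq ?_)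
    field_simp

/-- Besides `u` and `v`, the extension property can prescribe adjacencies to `k - 3` more vertices.
Their `2^(k-3)` patterns give distinct vertices joined to `u` and not to `v`, too many for all to be
unpinned. -/
theorem exists_isPinned_of_hasExtension {k : ℕ} {f : Sym2 V → Bool} (hk : 3 ≤ k)
    (hV : k ≤ Fintype.card V) (hext : HasExtension (k - 1) (graphOf f))
    (hbad : ∑ w, ind (¬ IsPinned k (graphOf f) w) < 2 ^ (k - 3)) {u v : V} (huv : u ≠ v) :
    ∃ w, IsPinned k (graphOf f) w ∧ ¬ ((graphOf f).Adj u w ↔ (graphOf f).Adj v w) := by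
  classical
  obtain ⟨S, hS, hScard⟩ := Finset.exists_subset_card_eq (s := ({u, v} : Finset V)ᶜ) (n := k - 3)
    (by rw [Finset.card_compl, Finset.card_pair huv]; omega)
  have huS : u ∉ S := fun h => by simpa using hS h
  have hvS : v ∉ S := fun h => by simpa using hS h
  have hcard : (insert u (insert v S)).card ≤ k - 1 :=
    (Finset.card_insert_le _ _).trans (by
      have := Finset.card_insert_le v S
      omega)
  choose z _ hz using fun T : Finset V => hext (insert u (insert v S)) (insert u T) hcard
  have hinj : Set.InjOn z (S.powerset : Set (Finset V)) := by
    intro T hT T' hT' h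
    have hT := Finset.mem_powerset.1 hT
    have hT' := Finset.mem_powerset.1 hT'
    have key : ∀ x ∈ S, x ∈ T ↔ x ∈ T' := by
      intro x hx
      have hxu : x ≠ u := fun h => huS (h ▸ hx)
      have h₁ := hz T x (by simp [hx])
      have h₂ := hz T' x (by simp [hx])
      rw [h] at h₁
      simpa [hxu] using h₁.symm.trans h₂
    ext x
    exact ⟨fun hx => (key x (hT hx)).1 hx, fun hx => (key x (hT' hx)).2 hx⟩
  by_contra hcon
  push Not at hcon
  have hsub : S.powerset.image z ⊆ Finset.univ.filter fun w => ¬ IsPinned k (graphOf f) w := by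
    intro w hw
    obtain ⟨T, hT, rfl⟩ := Finset.mem_image.1 hw
    have hT := Finset.mem_powerset.1 hT
    simp only [Finset.mem_filter, Finset.mem_univ, true_and]
    intro hpin
    have h₁ := hcon _ hpin
    have h₂ : (graphOf f).Adj (z T) u := (hz T u (by simp)).2 (by simp)
    have h₃ : ¬ (graphOf f).Adj (z T) v := fun h => by
      have := (hz T v (by simp)).1 h
      simp only [Finset.mem_insert, huv.symm, false_or] at this
      exact hvS (hT this)
    exact h₃ (h₁.1 h₂.symm).symm
  have h₁ := Finset.card_le_card hsub
  rw [Finset.card_image_of_injOn hinj, Finset.card_powerset, hScard] at h₁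
  rw [sum_ind_eq_card] at hbad
  have h₂ : ((2 ^ (k - 3) : ℕ) : ℝ) ≤ _ := Nat.cast_le.2 h₁
  push_cast at h₂
  exact absurd hbad (not_lt.2 h₂)

end Pinned

/-! ### Estimates for `n = k² 2^(k-1)` -/

section Estimates

/-- The number of vertices for which the expected number of common neighbours of `k` vertices is
about `k ^ 2 / 2`. -/
def vertexCount (k : ℕ) : ℕ := k ^ 2 * 2 ^ (k - 1)

theorem vertexCount_mul_half_pow {k : ℕ} (hk : 1 ≤ k) :
    (vertexCount k : ℝ) * (1 / 2) ^ k = k ^ 2 / 2 := by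
  obtain ⟨k, rfl⟩ := Nat.exists_eq_add_of_le' hk
  simp only [vertexCount, Nat.add_sub_cancel]
  push_cast
  rw [mul_assoc, pow_succ (1 / 2 : ℝ), ← mul_assoc (2 ^ k : ℝ), ← mul_pow]
  norm_num
  ring

theorem sq_le_two_pow {k : ℕ} (hk : 4 ≤ k) : k ^ 2 ≤ 2 ^ k := by
  induction k, hk using Nat.le_induction with
  | base => norm_num
  | succ k hk ih =>
    have : 2 ^ (k + 1) = 2 * 2 ^ k := by ring
    nlinarith

theorem two_mul_add_two_le_vertexCount {k : ℕ} (hk : 4 ≤ k) : 2 * k + 2 ≤ vertexCount k := by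
  have : 1 ≤ 2 ^ (k - 1) := Nat.one_le_two_pow
  unfold vertexCount
  nlinarith

theorem half_pow_le {k : ℕ} (hk : 4 ≤ k) : (1 / 2 : ℝ) ^ k ≤ 1 / 16 :=
  (pow_le_pow_of_le_one (by norm_num) (by norm_num) hk).trans (by norm_num)

theorem sq_mul_half_pow_le {k : ℕ} (hk : 4 ≤ k) : (k : ℝ) ^ 2 * (1 / 2) ^ k ≤ 1 := by
  have h : (k : ℝ) ^ 2 ≤ 2 ^ k := by exact_mod_cast sq_le_two_pow hk
  rw [one_div, inv_pow, ← div_eq_mul_inv]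
  exact div_le_one_of_le₀ h (by positivity)

theorem two_pow_mul_le {s k : ℕ} (h : s ≤ k) : 2 ^ s * k ≤ k + s * 2 ^ k := by
  induction k, h using Nat.le_induction with
  | base => rw [mul_comm]; exact Nat.le_add_left _ _
  | succ k hk ih =>
    rcases Nat.eq_zero_or_pos s with rfl | hs
    · simp
    have : 2 ^ s ≤ s * 2 ^ k := by
      calc 2 ^ s ≤ 2 ^ k := Nat.pow_le_pow_right (by norm_num) hk
        _ ≤ s * 2 ^ k := Nat.le_mul_of_pos_left _ hs
    rw [pow_succ]
    linarith

/-- The convex function `2^s` lies below its chord on `[0, k]`. Linearity in `s` is what turns the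
second moment bound into the form `A * B ^ s`. -/
theorem half_pow_mul_two_pow_le {s k : ℕ} (hk : 1 ≤ k) (h : s ≤ k) :
    (1 / 2 : ℝ) ^ k * 2 ^ s ≤ (1 / 2) ^ k + s / k := by
  have h₁ : (2 : ℝ) ^ s * k ≤ k + s * 2 ^ k := by exact_mod_cast two_pow_mul_le h
  have hk' : (0 : ℝ) < k := by exact_mod_cast hk
  rw [one_div, inv_pow]
  have h2 : (0 : ℝ) < 2 ^ k := by positivity
  rw [inv_eq_one_div, div_mul_eq_mul_div, one_mul, div_add_div _ _ h2.ne' hk'.ne', div_le_div_iff₀ h2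
    (by positivity)]
  nlinarith

theorem exp_neg_le_one_sub {q : ℝ} (hq₁ : q ≤ 1 / 2) :
    Real.exp (-(q + 2 * q ^ 2)) ≤ 1 - q := by
  have h : 0 < 1 - q := by linarith
  rw [← Real.le_log_iff_exp_le h]
  refine le_trans ?_ (Real.one_sub_inv_le_log_of_pos h)
  have : (1 - q)⁻¹ ≤ 1 + q + 2 * q ^ 2 := by
    rw [inv_le_iff_one_le_mul₀ h]
    nlinarith [mul_nonneg (sq_nonneg q) (by linarith : 0 ≤ 1 - 2 * q)]
  linarith

theorem isolates_pair_bound {k : ℕ} (hk : 4 ≤ k) {s : ℕ} (hs : s ≤ k) :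
    (1 / 2 : ℝ) ^ (2 * k - s) * (1 - 2 * (1 / 2) ^ k + (1 / 2) ^ (2 * k - s)) ^
      (vertexCount k - (2 * k - s + 1)) ≤
    ((1 / 2) ^ k * (1 - (1 / 2) ^ k) ^ (vertexCount k - (k + 1))) ^ 2 *
      (Real.exp (4 * k * (1 / 2) ^ k + 5 / 8 * k ^ 2 * (1 / 2) ^ k) *
        (2 * Real.exp (5 / 8 * k)) ^ s) := by
  have hn := two_mul_add_two_le_vertexCount hk
  have hnq := vertexCount_mul_half_pow (k := k) (by omega)
  have hq := half_pow_le hk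
  have hsq := half_pow_mul_two_pow_le (by omega : 1 ≤ k) hs
  have hpow : (1 / 2 : ℝ) ^ (2 * k - s) = ((1 / 2) ^ k) ^ 2 * 2 ^ s := by
    have h₁ : (1 / 2 : ℝ) ^ (2 * k - s) * (1 / 2) ^ s = ((1 / 2) ^ k) ^ 2 := by
      rw [← pow_add, ← pow_mul]
      congr 1
      omega
    rw [← h₁, mul_assoc, ← mul_pow]
    norm_num
  have hq₀ : (0 : ℝ) < (1 / 2) ^ k := by positivity
  rw [hpow]
  set q : ℝ := (1 / 2) ^ k with hqdef
  set n := vertexCount k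
  have hk₀ : (0 : ℝ) < k := by exact_mod_cast (by omega : 0 < k)
  set m := n - (2 * k - s + 1) with hm
  have hx : 0 ≤ q ^ 2 * 2 ^ s := by positivity
  -- The factor `5/4` absorbs `(1 - q)²`, as `q ≤ 1/16`; with `nq = k²/2` it produces the constant
  -- `5/8`.
  have hbase : 1 - 2 * q + q ^ 2 * 2 ^ s ≤ (1 - q) ^ 2 * Real.exp (5 / 4 * (q ^ 2 * 2 ^ s)) := by
    have h₁ := Real.add_one_le_exp (5 / 4 * (q ^ 2 * 2 ^ s))
    have h₂ : (1 : ℝ) ≤ 5 / 4 * (1 - q) ^ 2 := by nlinarith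
    calc 1 - 2 * q + q ^ 2 * 2 ^ s ≤ (1 - q) ^ 2 * (5 / 4 * (q ^ 2 * 2 ^ s) + 1) := by nlinarith
      _ ≤ _ := by gcongr
  have hbase₀ : 0 ≤ 1 - 2 * q + q ^ 2 * 2 ^ s := by nlinarith
  have hexp : (m : ℝ) * (5 / 4 * (q ^ 2 * 2 ^ s)) ≤ 5 / 8 * k ^ 2 * q + 5 / 8 * k * s := by
    calc (m : ℝ) * (5 / 4 * (q ^ 2 * 2 ^ s)) ≤ n * (5 / 4 * (q ^ 2 * 2 ^ s)) := by
          gcongr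
          exact_mod_cast Nat.sub_le _ _
      _ = 5 / 8 * k ^ 2 * (q * 2 ^ s) := by
          calc _ = 5 / 4 * ((n : ℝ) * q) * (q * 2 ^ s) := by ring
            _ = _ := by rw [hnq]; ring
      _ ≤ 5 / 8 * k ^ 2 * (q + s / k) := by gcongr
      _ = _ := by field_simp
  -- The squared probability `p²` carries `2(k - s)` more factors `1 - q` than the pair event
  -- supplies; `exp (4kq)` compensates for them.
  have hone : 1 ≤ (1 - q) ^ (2 * (k - s)) * Real.exp (4 * k * q) := by
    have h₁ : Real.exp (-(2 * q)) ≤ 1 - q :=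
      le_trans (Real.exp_le_exp.2 (by nlinarith)) (exp_neg_le_one_sub (by linarith))
    have h₂ : Real.exp (-(2 * q)) ^ (2 * (k - s)) ≤ (1 - q) ^ (2 * (k - s)) := by gcongr
    have h₃ : (((k - s : ℕ) : ℝ)) ≤ k := by exact_mod_cast Nat.sub_le _ _
    calc (1 : ℝ) ≤ Real.exp (-(2 * q)) ^ (2 * (k - s)) * Real.exp (4 * k * q) := by
          rw [← Real.exp_nat_mul, ← Real.exp_add]
          refine Real.one_le_exp ?_
          push_cast
          nlinarith
      _ ≤ _ := by gcongr
  have hm' : 2 * (n - (k + 1)) = 2 * m + 2 * (k - s) := by omega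
  calc q ^ 2 * 2 ^ s * (1 - 2 * q + q ^ 2 * 2 ^ s) ^ m
      ≤ q ^ 2 * 2 ^ s * ((1 - q) ^ 2 * Real.exp (5 / 4 * (q ^ 2 * 2 ^ s))) ^ m := by gcongr
    _ = q ^ 2 * 2 ^ s * ((1 - q) ^ (2 * m) * 1 *
          Real.exp (m * (5 / 4 * (q ^ 2 * 2 ^ s)))) := by
        rw [mul_pow, ← pow_mul (1 - q), ← Real.exp_nat_mul, mul_one]
    _ ≤ q ^ 2 * 2 ^ s * ((1 - q) ^ (2 * m) * ((1 - q) ^ (2 * (k - s)) * Real.exp (4 * k * q)) *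
          Real.exp (5 / 8 * k ^ 2 * q + 5 / 8 * k * s)) := by
        have : 0 ≤ (1 - q) ^ (2 * m) := by rw [pow_mul]; positivity
        gcongr
    _ = _ := by
        rw [mul_pow q, ← pow_mul (1 - q), mul_comm (n - (k + 1)) 2, hm', pow_add, mul_pow 2,
          ← Real.exp_nat_mul, Real.exp_add, Real.exp_add]
        ring_nf

theorem isolates_lower_bound {k : ℕ} (hk : 4 ≤ k) :
    (1 / 2) ^ k * Real.exp (-(k ^ 2 / 2) - 1) ≤
      (1 / 2) ^ k * (1 - (1 / 2 : ℝ) ^ k) ^ (vertexCount k - (k + 1)) := by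
  have hnq := vertexCount_mul_half_pow (k := k) (by omega)
  have hq := half_pow_le hk
  have hkq := sq_mul_half_pow_le hk
  have hq₀ : (0 : ℝ) < (1 / 2) ^ k := by positivity
  gcongr
  set q : ℝ := (1 / 2) ^ k
  calc Real.exp (-(k ^ 2 / 2) - 1) ≤ Real.exp (-(q + 2 * q ^ 2)) ^ vertexCount k := by
        rw [← Real.exp_nat_mul, Real.exp_le_exp]
        have : (vertexCount k : ℝ) * -(q + 2 * q ^ 2) =
          -(vertexCount k * q) - 2 * (vertexCount k * q) * q := by ring
        rw [this, hnq]
        linarith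
    _ ≤ (1 - q) ^ vertexCount k := by
        gcongr
        exact exp_neg_le_one_sub (by linarith)
    _ ≤ _ := pow_le_pow_of_le_one (by linarith) (by linarith) (Nat.sub_le _ _)

theorem choose_two_sub_choose_two {k j : ℕ} (hj : j ≤ k) :
    k.choose 2 - (k - j).choose 2 + j.choose 2 + j = k * j := by
  obtain ⟨i, rfl⟩ := Nat.exists_eq_add_of_le hj
  have h₁ : (j + i).choose 2 = j.choose 2 + i.choose 2 + j * i := by
    rw [Nat.add_choose_eq]
    simp [Finset.Nat.antidiagonal_succ]
    ring
  have h₂ : 2 * j.choose 2 = j * (j - 1) := by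
    rw [Nat.choose_two_right]
    exact Nat.mul_div_cancel' (Nat.even_mul_pred_self j).two_dvd
  rw [Nat.add_sub_cancel_left, h₁]
  rcases j with _ | j
  · simp
  · simp only [Nat.add_sub_cancel] at h₂
    have : (j + 1).choose 2 + i.choose 2 + (j + 1) * i - i.choose 2 =
      (j + 1).choose 2 + (j + 1) * i := by omega
    rw [this]
    nlinarith

/-- For `j ≥ 4` this is `ln 2 / 2 < 7/20` with room to spare; smaller `j` are checked directly. The
term `(1/2) ^ j / 2` cancels the overlap gain in `coincidence_bound`, leaving `7/16 - 1 = -9/16`. -/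
theorem choose_two_mul_log_two_le {k j : ℕ} (hk : 4 ≤ k) (hj : 1 ≤ j) (hjk : j ≤ k) :
    (j.choose 2 : ℝ) * Real.log 2 ≤ k ^ 2 * (7 / 16 - (1 / 2) ^ j / 2) := by
  have hlog := Real.log_two_lt_d9
  have hlog₀ : 0 < Real.log 2 := Real.log_pos (by norm_num)
  have hk' : (4 : ℝ) ≤ k := by exact_mod_cast hk
  have hjk' : (j : ℝ) ≤ k := by exact_mod_cast hjk
  rw [Nat.cast_choose_two]
  rcases (by omega : j = 1 ∨ j = 2 ∨ j = 3 ∨ 4 ≤ j) with rfl | rfl | rfl | h4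
  · norm_num
  · norm_num; nlinarith
  · norm_num; nlinarith
  · have h := half_pow_le h4
    have h4' : (4 : ℝ) ≤ j := by exact_mod_cast h4
    have h₁ : (j : ℝ) * (j - 1) / 2 ≤ k ^ 2 / 2 := by nlinarith
    have h₂ : (j : ℝ) * (j - 1) / 2 * Real.log 2 ≤ k ^ 2 / 2 * (7 / 10) := by
      gcongr
      linarith
    nlinarith [sq_nonneg (k : ℝ)]

/-- The `n^j` choices of new vertices nearly cancel against the `kj - j - C(j,2)` forced bits,
leaving `k^(2j) 2^C(j,2)`. Avoiding two tuples costs about `exp (-(2 - 2^(-j)) k²/2)`, which beats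
this surplus. -/
theorem coincidence_bound {k : ℕ} (hk : 4 ≤ k) {j : ℕ} (hj : 1 ≤ j) (hjk : j ≤ k) :
    (1 / 2 : ℝ) ^ (k.choose 2 - (k - j).choose 2) *
      (1 - 2 * (1 / 2) ^ k + (1 / 2) ^ (k + j)) ^ (vertexCount k - (2 * k + 2)) ≤
    (k : ℝ) ^ (2 * k) * Real.exp (4 - 9 / 16 * k ^ 2) * (vertexCount k : ℝ)⁻¹ ^ j := by
  have hn := two_mul_add_two_le_vertexCount hk
  have hnq := vertexCount_mul_half_pow (k := k) (by omega)
  have hq := half_pow_le hk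
  have hkq := sq_mul_half_pow_le hk
  have hk' : (4 : ℝ) ≤ k := by exact_mod_cast hk
  have hn₀ : (0 : ℝ) < vertexCount k := by exact_mod_cast (by omega : 0 < vertexCount k)
  have hnj : (vertexCount k : ℝ) ^ j * (1 / 2) ^ (k.choose 2 - (k - j).choose 2) ≤
      k ^ (2 * k) * 2 ^ j.choose 2 := by
    have h₁ : (vertexCount k : ℝ) ^ j ≤ k ^ (2 * k) * 2 ^ (k * j - j) := by
      have : (vertexCount k : ℝ) ^ j = k ^ (2 * j) * 2 ^ (k * j - j) := by
        unfold vertexCount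
        push_cast
        rw [mul_pow, ← pow_mul, ← pow_mul]
        congr 2
        rw [Nat.sub_mul, one_mul]
      rw [this]
      gcongr
      · linarith
    have h₂ : k * j - j = (k.choose 2 - (k - j).choose 2) + j.choose 2 := by
      have := choose_two_sub_choose_two hjk
      omega
    calc _ ≤ (k : ℝ) ^ (2 * k) * 2 ^ (k * j - j) *
          (1 / 2) ^ (k.choose 2 - (k - j).choose 2) := by gcongr
      _ = k ^ (2 * k) * 2 ^ j.choose 2 *
          (2 ^ (k.choose 2 - (k - j).choose 2) * (1 / 2) ^ (k.choose 2 - (k - j).choose 2)) := by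
        rw [h₂, pow_add]; ring
      _ = _ := by rw [← mul_pow]; norm_num
  have hq₀ : (0 : ℝ) < (1 / 2) ^ k := by positivity
  rw [inv_pow, ← div_eq_mul_inv, le_div_iff₀ (by positivity), pow_add (1 / 2 : ℝ) k j]
  set q : ℝ := (1 / 2) ^ k
  have hr₀ : (0 : ℝ) < (1 / 2) ^ j := by positivity
  have hr₁ : (1 / 2 : ℝ) ^ j ≤ 1 := pow_le_one₀ (by norm_num) (by norm_num)
  have hch := choose_two_mul_log_two_le hk hj hjk
  set r : ℝ := (1 / 2) ^ j
  have hpow : (1 - 2 * q + q * r) ^ (vertexCount k - (2 * k + 2)) ≤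
      Real.exp (4 - (2 - r) * (k ^ 2 / 2)) := by
    calc (1 - 2 * q + q * r) ^ (vertexCount k - (2 * k + 2))
        ≤ Real.exp (-(q * (2 - r))) ^ (vertexCount k - (2 * k + 2)) := by
          refine pow_le_pow_left₀ (by nlinarith) ?_ _
          have := Real.add_one_le_exp (-(q * (2 - r)))
          linarith
      _ ≤ _ := by
          rw [← Real.exp_nat_mul, Real.exp_le_exp, Nat.cast_sub hn, ← hnq]
          push_cast
          have h₁ : q * (2 * k + 2) ≤ 1 := by nlinarith
          have h₂ : q * (2 * k + 2) * (2 - r) ≤ 1 * 2 := by gcongr <;> linarith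
          linarith
  calc _ = (vertexCount k : ℝ) ^ j * (1 / 2) ^ (k.choose 2 - (k - j).choose 2) *
        (1 - 2 * q + q * r) ^ (vertexCount k - (2 * k + 2)) := by ring
    _ ≤ (k : ℝ) ^ (2 * k) * 2 ^ j.choose 2 * Real.exp (4 - (2 - r) * (k ^ 2 / 2)) := by
        refine mul_le_mul hnj hpow (pow_nonneg (by nlinarith) _) (by positivity)
    _ = (k : ℝ) ^ (2 * k) * Real.exp (j.choose 2 * Real.log 2 + (4 - (2 - r) * (k ^ 2 / 2))) := by
        rw [Real.exp_add, Real.exp_nat_mul, Real.exp_log (by norm_num)]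
        ring
    _ ≤ _ := by
        gcongr
        linarith

end Estimates

/-! ### Asymptotics of the error probabilities -/

section Asymptotics

open Filter Topology

theorem eventually_log_le {ε : ℝ} (hε : 0 < ε) :
    ∀ᶠ k : ℕ in atTop, Real.log (k + 1) ≤ ε * (k + 1) := by
  have h₁ : Tendsto (fun k : ℕ => (k : ℝ) + 1) atTop atTop :=
    tendsto_atTop_add_const_right _ _ tendsto_natCast_atTop_atTop
  filter_upwards [h₁.eventually (Real.isLittleO_log_id_atTop.bound hε)] with k hk
  simp only [id_eq, Real.norm_eq_abs] at hk
  rw [abs_of_nonneg (by positivity : (0 : ℝ) ≤ (k : ℝ) + 1)] at hk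
  exact (le_abs_self _).trans hk

theorem tendsto_exp_neg_nat : Tendsto (fun k : ℕ => Real.exp (-(k : ℝ))) atTop (𝓝 0) :=
  Real.tendsto_exp_neg_atTop_nhds_zero.comp tendsto_natCast_atTop_atTop

/-- The probability that the extension property for `k - 1` vertices fails. -/
noncomputable def extensionError (k : ℕ) : ℝ :=
  avg (fun f : Sym2 (Fin (vertexCount k)) → Bool => ind (¬ HasExtension (k - 1) (graphOf f)))

/-- There are at most about `exp (k² ln 2)` patterns up to lower order, and each is missed with
probability about `exp (-k²)`, because `n 2^(-(k-1)) = k²`; the bound tends to zero since `ln 2 <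
1`. -/
theorem extensionError_le {k : ℕ} (hk : 4 ≤ k) :
    extensionError k ≤ Real.exp (2 * k * Real.log (k + 1) + k ^ 2 * Real.log 2 - k ^ 2 + 2) := by
  have hn := two_mul_add_two_le_vertexCount hk
  have hnq := vertexCount_mul_half_pow (k := k) (by omega)
  have hkq := sq_mul_half_pow_le hk
  have hk' : (4 : ℝ) ≤ k := by exact_mod_cast hk
  have h := avg_ind_not_hasExtension_le (V := Fin (vertexCount k)) (M := k - 1)
    (by rw [Fintype.card_fin]; omega)
  rw [Fintype.card_fin] at h
  have hq₀ : (0 : ℝ) < (1 / 2) ^ k := by positivity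
  have h2n : 2 * (vertexCount k : ℝ) = k ^ 2 * 2 ^ k := by
    have : (2 : ℝ) ^ k = 2 * 2 ^ (k - 1) := by rw [← pow_succ']; congr 1; omega
    rw [this]
    unfold vertexCount
    push_cast
    ring
  have h₁ : (2 * (vertexCount k : ℝ)) ^ (k - 1) ≤
      Real.exp (2 * k * Real.log (k + 1) + k ^ 2 * Real.log 2) := by
    have h2k : (1 : ℝ) ≤ 2 ^ k := one_le_pow₀ (by norm_num)
    calc (2 * (vertexCount k : ℝ)) ^ (k - 1) ≤ (2 * (vertexCount k : ℝ)) ^ k := by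
          refine pow_le_pow_right₀ ?_ (Nat.sub_le _ _)
          rw [h2n]
          nlinarith
      _ ≤ ((k + 1) ^ 2 * 2 ^ k) ^ k := by
          rw [h2n]
          gcongr
          linarith
      _ = _ := by
          rw [show 2 * (k : ℝ) * Real.log (k + 1) + k ^ 2 * Real.log 2 =
            ((2 * k : ℕ) : ℝ) * Real.log (k + 1) + ((k * k : ℕ) : ℝ) * Real.log 2 by
              push_cast; ring, Real.exp_add, Real.exp_nat_mul, Real.exp_nat_mul,
            Real.exp_log (by positivity), Real.exp_log (by norm_num), mul_pow, ← pow_mul, ← pow_mul]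
  have hx : (1 / 2 : ℝ) ^ (k - 1) = 2 * (1 / 2) ^ k := by
    obtain ⟨l, rfl⟩ := Nat.exists_eq_add_of_le' (by omega : 1 ≤ k)
    rw [Nat.add_sub_cancel, pow_succ]
    ring
  have h₂ : (1 - (1 / 2 : ℝ) ^ (k - 1)) ^ (vertexCount k - (k - 1)) ≤
      Real.exp (-k ^ 2 + 2) := by
    calc _ ≤ Real.exp (-(1 / 2 : ℝ) ^ (k - 1)) ^ (vertexCount k - (k - 1)) := by
          refine pow_le_pow_left₀ ?_ ?_ _
          · have : ((1 : ℝ) / 2) ^ (k - 1) ≤ 1 := pow_le_one₀ (by norm_num) (by norm_num)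
            linarith
          · have := Real.add_one_le_exp (-(1 / 2 : ℝ) ^ (k - 1))
            linarith
      _ ≤ _ := by
          rw [← Real.exp_nat_mul, Real.exp_le_exp, hx, Nat.cast_sub (by omega),
            Nat.cast_sub (by omega)]
          push_cast
          nlinarith
  refine h.trans ?_
  rw [show 2 * (k : ℝ) * Real.log (k + 1) + k ^ 2 * Real.log 2 - k ^ 2 + 2 =
    (2 * k * Real.log (k + 1) + k ^ 2 * Real.log 2) + (-k ^ 2 + 2) by ring, Real.exp_add]
  refine mul_le_mul h₁ h₂ (pow_nonneg ?_ _) (Real.exp_nonneg _)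
  have : ((1 : ℝ) / 2) ^ (k - 1) ≤ 1 := pow_le_one₀ (by norm_num) (by norm_num)
  linarith

theorem tendsto_extensionError : Tendsto extensionError atTop (𝓝 0) := by
  refine squeeze_zero' (Eventually.of_forall fun k => avg_nonneg fun f => ind_nonneg _) ?_
    tendsto_exp_neg_nat
  filter_upwards [eventually_ge_atTop 100, eventually_log_le (by norm_num : (0 : ℝ) < 1 / 100)]
    with k hk hlog
  refine (extensionError_le (by omega)).trans (Real.exp_le_exp.2 ?_)
  have hk' : (100 : ℝ) ≤ k := by exact_mod_cast hk
  have hlog2 := Real.log_two_lt_d9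
  have h₁ : 2 * (k : ℝ) * Real.log (k + 1) ≤ 2 * k * (1 / 100 * (k + 1)) := by gcongr
  have h₂ : (k : ℝ) ^ 2 * Real.log 2 ≤ k ^ 2 * (7 / 10) := by gcongr; linarith
  nlinarith

/-- A bound for the probability that a given vertex is not pinned. -/
noncomputable def pinError (k : ℕ) : ℝ :=
  4 * (Real.exp (4 * k * (1 / 2) ^ k + 5 / 8 * k ^ 2 * (1 / 2) ^ k) *
    (((2 ^ k : ℕ) - 1 + 2 * Real.exp (5 / 8 * k)) / (2 ^ k : ℕ)) ^ k - 1) +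
  2 * ((vertexCount k * (k ^ (2 * k) * Real.exp (4 - 9 / 16 * k ^ 2) * (k + 1) ^ k)) /
    ((1 / 2) ^ k * (1 - (1 / 2) ^ k) ^ (vertexCount k - (k + 1))))

theorem avg_ind_not_isPinned_le_pinError {k : ℕ} (hk : 4 ≤ k) (w : Fin (vertexCount k)) :
    avg (fun f => ind (¬ IsPinned k (graphOf f) w)) ≤ pinError k := by
  -- The `k` disjoint blocks of size `2^k` must fit among the vertices other than `w`; `k ≥ 4` is
  -- enough.
  have hcard : Fintype.card (Fin k × Fin (2 ^ k)) ≤ Fintype.card {v // v ≠ w} := by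
    rw [Fintype.card_prod, Fintype.card_fin, Fintype.card_fin, Fintype.card_subtype_compl,
      Fintype.card_fin, Fintype.card_subtype_eq, vertexCount]
    have h₁ : 2 ^ k = 2 * 2 ^ (k - 1) := by rw [← pow_succ']; congr 1; omega
    have h₂ : 1 ≤ 2 ^ (k - 1) := Nat.one_le_two_pow
    refine Nat.le_sub_of_add_le ?_
    have h₃ : k * 2 ^ (k - 1) * 4 ≤ k * 2 ^ (k - 1) * k := Nat.mul_le_mul_left _ hk
    have h₄ : 1 ≤ k * 2 ^ (k - 1) := Nat.mul_pos (by omega) (by omega)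
    calc k * 2 ^ k + 1 ≤ k * 2 ^ (k - 1) * 4 := by rw [h₁]; linarith
      _ ≤ _ := h₃
      _ = _ := by ring
  obtain ⟨ι⟩ := Function.Embedding.nonempty_of_card_le hcard
  have hq := half_pow_le hk
  have hq₁ : (0 : ℝ) < 1 - (1 / 2) ^ k := by linarith
  have hcardV := Fintype.card_fin (vertexCount k)
  have key := avg_ind_not_isPinned_le (N := 2 ^ k)
    (A := Real.exp (4 * k * (1 / 2) ^ k + 5 / 8 * k ^ 2 * (1 / 2) ^ k))
    (B := 2 * Real.exp (5 / 8 * k))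
    (c := vertexCount k * (k ^ (2 * k) * Real.exp (4 - 9 / 16 * k ^ 2) * (k + 1) ^ k))
    (by positivity) w (ι.trans (Function.Embedding.subtype _)) (fun p => (ι p).2) rfl
    (by positivity) (fun s hs => ?_) (fun X hX => ?_)
  · rwa [hcardV] at key
  · rw [hcardV]
    exact isolates_pair_bound hk hs
  · have := avg_ind_isolates_and_isConfused_le hX (w := w)
      (h := (k : ℝ) ^ (2 * k) * Real.exp (4 - 9 / 16 * k ^ 2)) (fun j hj hjk => ?_)
      (by positivity)
    · rwa [hcardV] at this
    · rw [hcardV]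
      exact coincidence_bound hk hj hjk

/-- The exponent controlling the second moment of the number of tuples with a given unique common
neighbour. -/
noncomputable def momentExponent (k : ℕ) : ℝ :=
  4 * k * (1 / 2) ^ k + 5 / 8 * k ^ 2 * (1 / 2) ^ k + 2 * k * (Real.exp (5 / 8) / 2) ^ k

theorem momentExponent_nonneg (k : ℕ) : 0 ≤ momentExponent k := by
  unfold momentExponent
  positivity

/-- This makes `B / N = 2 (exp (5/8) / 2)^k` decay geometrically, so overlapping transversals do not
spoil the second moment. -/
theorem exp_five_eighths_lt_two : Real.exp (5 / 8) < 2 := by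
  have h₁ : Real.exp (5 / 8) ^ 8 = Real.exp 1 ^ 5 := by
    rw [← Real.exp_nat_mul, ← Real.exp_nat_mul]
    norm_num
  have h₂ : Real.exp 1 ^ 5 < 2 ^ 8 := by
    calc Real.exp 1 ^ 5 < 3 ^ 5 := by
          gcongr
          exact Real.exp_one_lt_d9.trans (by norm_num)
      _ < 2 ^ 8 := by norm_num
  exact lt_of_pow_lt_pow_left₀ 8 (by norm_num) (h₁ ▸ h₂)

theorem tendsto_sq_mul_momentExponent :
    Tendsto (fun k : ℕ => (k : ℝ) ^ 2 * momentExponent k) atTop (𝓝 0) := by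
  have h₁ := tendsto_pow_const_mul_const_pow_of_abs_lt_one 3
    (by rw [abs_of_pos] <;> norm_num : |(1 / 2 : ℝ)| < 1)
  have h₂ := tendsto_pow_const_mul_const_pow_of_abs_lt_one 4
    (by rw [abs_of_pos] <;> norm_num : |(1 / 2 : ℝ)| < 1)
  have h₃ := tendsto_pow_const_mul_const_pow_of_abs_lt_one 3
    (by
      rw [abs_of_pos (by positivity), div_lt_one (by norm_num)]
      exact exp_five_eighths_lt_two : |Real.exp (5 / 8) / 2| < 1)
  have := ((h₁.const_mul 4).add (h₂.const_mul (5 / 8))).add (h₃.const_mul 2)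
  simp only [mul_zero, add_zero] at this
  refine this.congr fun k => ?_
  unfold momentExponent
  ring

theorem moment_ratio_le (k : ℕ) :
    Real.exp (4 * k * (1 / 2) ^ k + 5 / 8 * k ^ 2 * (1 / 2) ^ k) *
      (((2 ^ k : ℕ) - 1 + 2 * Real.exp (5 / 8 * k)) / (2 ^ k : ℕ)) ^ k ≤
    Real.exp (momentExponent k) := by
  have h2 : (0 : ℝ) < 2 ^ k := by positivity
  have h2' : (1 : ℝ) ≤ 2 ^ k := one_le_pow₀ (by norm_num)
  have hB : Real.exp (5 / 8 * k) = Real.exp (5 / 8) ^ k := by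
    rw [← Real.exp_nat_mul, mul_comm]
  have h₁ : (((2 ^ k : ℕ) : ℝ) - 1 + 2 * Real.exp (5 / 8 * k)) / (2 ^ k : ℕ) ≤
      Real.exp (2 * (Real.exp (5 / 8) / 2) ^ k) := by
    refine le_trans ?_ (Real.add_one_le_exp _)
    push_cast
    rw [div_le_iff₀ h2, hB, div_pow, add_mul, mul_assoc, div_mul_cancel₀ _ h2.ne']
    linarith
  rw [momentExponent, Real.exp_add (_ + _)]
  gcongr
  calc _ ≤ Real.exp (2 * (Real.exp (5 / 8) / 2) ^ k) ^ k := by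
        gcongr
        push_cast
        exact div_nonneg (by linarith [Real.exp_nonneg (5 / 8 * (k : ℝ))]) h2.le
    _ = _ := by
        rw [← Real.exp_nat_mul]
        ring_nf

/-- The confusion bound `exp (-9k²/16)` divided by `p ≈ exp (-k²/2)` leaves `exp (-k²/16)`, which
dominates all factors `exp (O(k log k))`. -/
theorem confusion_ratio_le {k : ℕ} (hk : 4 ≤ k) :
    (k : ℝ) ^ 2 * ((vertexCount k * (k ^ (2 * k) * Real.exp (4 - 9 / 16 * k ^ 2) * (k + 1) ^ k)) /
      ((1 / 2) ^ k * (1 - (1 / 2) ^ k) ^ (vertexCount k - (k + 1)))) ≤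
    Real.exp ((3 * k + 4) * Real.log (k + 1) + 2 * k + 5 - k ^ 2 / 16) := by
  have hlow := isolates_lower_bound hk
  have hnq := vertexCount_mul_half_pow (k := k) (by omega)
  have hk' : (4 : ℝ) ≤ k := by exact_mod_cast hk
  have hn : (vertexCount k : ℝ) = k ^ 2 / 2 * 2 ^ k := by
    rw [← hnq, mul_assoc, ← mul_pow]
    norm_num
  have h4 : (2 : ℝ) ^ k * 2 ^ k ≤ Real.exp (2 * k) := by
    rw [← mul_pow, mul_comm (2 : ℝ) k, Real.exp_nat_mul]
    gcongr
    have := Real.quadratic_le_exp_of_nonneg (by norm_num : (0 : ℝ) ≤ 2)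
    linarith
  have hinv : ((1 / 2 : ℝ) ^ k * Real.exp (-(k ^ 2 / 2) - 1))⁻¹ =
      2 ^ k * Real.exp (k ^ 2 / 2 + 1) := by
    rw [mul_inv, ← Real.exp_neg, one_div, inv_pow, inv_inv]
    ring_nf
  calc _ ≤ (k : ℝ) ^ 2 * ((vertexCount k * (k ^ (2 * k) * Real.exp (4 - 9 / 16 * k ^ 2) *
        (k + 1) ^ k)) / ((1 / 2) ^ k * Real.exp (-(k ^ 2 / 2) - 1))) := by gcongr
    _ = (k : ℝ) ^ 2 * (k ^ 2 / 2) * (k ^ (2 * k) * (k + 1) ^ k) * (2 ^ k * 2 ^ k) *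
        Real.exp (5 - k ^ 2 / 16) := by
      rw [div_eq_mul_inv, hinv, hn, show (5 : ℝ) - k ^ 2 / 16 =
        (4 - 9 / 16 * k ^ 2) + (k ^ 2 / 2 + 1) by ring,
        Real.exp_add (4 - 9 / 16 * (k : ℝ) ^ 2)]
      ring
    _ ≤ ((k : ℝ) + 1) ^ 2 * (k + 1) ^ 2 * ((k + 1) ^ (2 * k) * (k + 1) ^ k) * Real.exp (2 * k) *
        Real.exp (5 - k ^ 2 / 16) := by
      gcongr
      · linarith
      · nlinarith
      · linarith
    _ = _ := by
      rw [show (3 * (k : ℝ) + 4) * Real.log (k + 1) + 2 * k + 5 - k ^ 2 / 16 =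
        ((3 * k + 4 : ℕ) : ℝ) * Real.log (k + 1) + 2 * k + (5 - k ^ 2 / 16) by push_cast; ring,
        Real.exp_add, Real.exp_add, Real.exp_nat_mul, Real.exp_log (by positivity)]
      ring

theorem eventually_sq_mul_pinError_le :
    ∀ᶠ k : ℕ in atTop, (k : ℝ) ^ 2 * pinError k ≤
      8 * (k ^ 2 * momentExponent k) + 2 * Real.exp (-(k : ℝ)) := by
  filter_upwards [eventually_ge_atTop 1000, eventually_log_le (by norm_num : (0 : ℝ) < 1 / 1000),
    tendsto_sq_mul_momentExponent.eventually (eventually_le_nhds zero_lt_one)] with k hk hlog hT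
  have hk' : (1000 : ℝ) ≤ k := by exact_mod_cast hk
  have hT₀ := momentExponent_nonneg k
  have hT₁ : momentExponent k ≤ 1 := by nlinarith
  have h₁ := moment_ratio_le k
  have h₂ : Real.exp (momentExponent k) - 1 ≤ 2 * momentExponent k := by
    have := Real.abs_exp_sub_one_le (x := momentExponent k) (by rwa [abs_of_nonneg hT₀])
    rw [abs_of_nonneg hT₀] at this
    exact (le_abs_self _).trans this
  have h₃ := confusion_ratio_le (by omega : 4 ≤ k)
  have h₄ : Real.exp ((3 * k + 4) * Real.log (k + 1) + 2 * k + 5 - k ^ 2 / 16) ≤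
      Real.exp (-(k : ℝ)) := by
    rw [Real.exp_le_exp]
    have : (3 * (k : ℝ) + 4) * Real.log (k + 1) ≤ (3 * k + 4) * (1 / 1000 * (k + 1)) := by gcongr
    nlinarith
  have h₅ : (k : ℝ) ^ 2 * (4 * (Real.exp (4 * k * (1 / 2) ^ k + 5 / 8 * k ^ 2 * (1 / 2) ^ k) *
    (((2 ^ k : ℕ) - 1 + 2 * Real.exp (5 / 8 * k)) / (2 ^ k : ℕ)) ^ k - 1)) ≤
      k ^ 2 * (4 * (2 * momentExponent k)) := by
    gcongr
    linarith
  rw [pinError, mul_add]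
  linarith

/-- The probability that too many vertices fail to be pinned. -/
noncomputable def unpinnedError (k : ℕ) : ℝ :=
  avg (fun f : Sym2 (Fin (vertexCount k)) → Bool =>
    ind ((2 : ℝ) ^ (k - 3) ≤ ∑ w, ind (¬ IsPinned k (graphOf f) w)))

/-- Markov with threshold `2^(k-3)`: the expected number is at most `n * pinError k`, and `n /
2^(k-3) = 4k²`. Hence `pinError` is needed to be `o(k⁻²)`. -/
theorem unpinnedError_le {k : ℕ} (hk : 4 ≤ k) : unpinnedError k ≤ 4 * (k ^ 2 * pinError k) := by
  refine (avg_ind_le_of_markov (fun f => Finset.sum_nonneg fun w _ => ind_nonneg _)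
    (by positivity)).trans ?_
  rw [avg_sum, div_le_iff₀ (by positivity)]
  refine (Finset.sum_le_sum fun w _ => avg_ind_not_isPinned_le_pinError hk w).trans (le_of_eq ?_)
  have : (2 : ℝ) ^ (k - 1) = 4 * 2 ^ (k - 3) := by
    rw [show k - 1 = k - 3 + 2 by omega, pow_add]
    ring
  have hv : (vertexCount k : ℝ) = k ^ 2 * 2 ^ (k - 1) := by simp [vertexCount]
  rw [Finset.sum_const, Finset.card_univ, Fintype.card_fin, nsmul_eq_mul, hv, this]
  ring

theorem tendsto_unpinnedError : Tendsto unpinnedError atTop (𝓝 0) := by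
  have h : Tendsto (fun k : ℕ => 4 * (8 * ((k : ℝ) ^ 2 * momentExponent k) +
      2 * Real.exp (-(k : ℝ)))) atTop (𝓝 0) := by
    simpa using ((tendsto_sq_mul_momentExponent.const_mul 8).add
      (tendsto_exp_neg_nat.const_mul 2)).const_mul 4
  refine squeeze_zero' (Eventually.of_forall fun k => avg_nonneg fun f => ind_nonneg _) ?_ h
  filter_upwards [eventually_ge_atTop 4, eventually_sq_mul_pinError_le] with k hk h₁
  exact (unpinnedError_le hk).trans (by linarith)

theorem prob_le_one (n : ℕ) (P : SimpleGraph (Fin n) → Prop) : prob n P ≤ 1 := by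
  rw [prob_eq_avg]
  exact (avg_mono fun f => ind_le_one _).trans (avg_const 1).le

theorem prob_mono {n : ℕ} {P Q : SimpleGraph (Fin n) → Prop} (h : ∀ G, P G → Q G) :
    prob n P ≤ prob n Q := by
  rw [prob_eq_avg, prob_eq_avg]
  exact avg_mono fun f => ind_mono (h _)

/-- Supplies the non-isomorphic opponent for the lower bound: the failure probability is below `1`
for some larger `k'`. -/
theorem exists_hasExtension (k : ℕ) :
    ∃ k' > k, ∃ H : SimpleGraph (Fin (vertexCount k')), HasExtension (k' - 1) H := by
  obtain ⟨k', h₁, h₂⟩ := ((tendsto_extensionError.eventually (gt_mem_nhds zero_lt_one)).and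
    (eventually_gt_atTop k)).exists
  refine ⟨k', h₂, ?_⟩
  by_contra hcon
  push Not at hcon
  have : extensionError k' = 1 := by
    unfold extensionError
    rw [← avg_const (E := Sym2 (Fin (vertexCount k'))) 1]
    congr 1
    funext f
    exact ind_of_true (hcon _)
  linarith

theorem vertexCount_lt {k k' : ℕ} (hk : 1 ≤ k) (h : k < k') : vertexCount k < vertexCount k' := by
  unfold vertexCount
  have h₁ : k ^ 2 < k' ^ 2 := Nat.pow_lt_pow_left h (by norm_num)
  have h₂ : 2 ^ (k - 1) ≤ 2 ^ (k' - 1) := Nat.pow_le_pow_right (by norm_num) (by omega)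
  exact Nat.mul_lt_mul_of_lt_of_le h₁ h₂ (by positivity)

/-- The definition depths of a graph on `vertexCount k` vertices lie between `k + 1` and
`k + 4`. -/
def HasDepths (k : ℕ) (G : SimpleGraph (Fin (vertexCount k))) : Prop :=
  ((k + 1 : ℕ) : ℕ∞) ≤ defDepth G ∧ defDepth G ≤ defDepthAlt 2 G ∧
    defDepthAlt 2 G ≤ ((k + 4 : ℕ) : ℕ∞)

theorem tendsto_prob_hasDepths :
    Tendsto (fun k => prob (vertexCount k) (HasDepths k)) atTop (𝓝 1) := by
  have h : Tendsto (fun k => 1 - (extensionError k + unpinnedError k)) atTop (𝓝 1) := by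
    simpa using (tendsto_extensionError.add tendsto_unpinnedError).const_sub 1
  refine tendsto_of_tendsto_of_tendsto_of_le_of_le' h tendsto_const_nhds ?_
    (Eventually.of_forall fun k => prob_le_one _ _)
  filter_upwards [eventually_ge_atTop 4] with k hk
  rw [prob_eq_avg, extensionError, unpinnedError, ← avg_add,
    ← avg_const (E := Sym2 (Fin (vertexCount k))) 1, ← avg_sub]
  refine avg_mono fun f => ?_
  by_cases h₁ : HasExtension (k - 1) (graphOf f)
  swap
  · have := ind_nonneg ((2 : ℝ) ^ (k - 3) ≤ ∑ w, ind (¬ IsPinned k (graphOf f) w))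
    have := ind_nonneg (HasDepths k (graphOf f))
    rw [ind_of_true h₁]
    linarith
  by_cases h₂ : (2 : ℝ) ^ (k - 3) ≤ ∑ w, ind (¬ IsPinned k (graphOf f) w)
  · have := ind_nonneg (¬ HasExtension (k - 1) (graphOf f))
    have := ind_nonneg (HasDepths k (graphOf f))
    rw [ind_of_true h₂]
    linarith
  rw [ind_of_true (p := HasDepths k (graphOf f)), ind_of_false (not_not.2 h₁), ind_of_false h₂]
  · norm_num
  refine ⟨?_, defDepth_le_defDepthAlt 2 _, defDepthAlt_le_of_isPinned _ fun u v huv =>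
    exists_isPinned_of_hasExtension (by omega) ?_ h₁ (not_le.1 h₂) huv⟩
  · obtain ⟨k', hk', H, hH⟩ := exists_hasExtension k
    have := le_defDepth_of_hasExtension h₁ (hH.mono (by omega)) (by
      rintro ⟨e⟩
      have := Fintype.card_congr e.toEquiv
      simp only [Fintype.card_fin] at this
      exact (vertexCount_lt (by omega) hk').ne this)
    rwa [show k - 1 + 2 = k + 1 by omega] at this
  · rw [Fintype.card_fin]
    have := two_mul_add_two_le_vertexCount hk
    omega

/-! ### Comparing `k` with the main term, and the conclusion -/

theorem log_vertexCount {k : ℕ} (hk : 1 ≤ k) :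
    Real.log (vertexCount k) = (k - 1) * Real.log 2 + 2 * Real.log k := by
  have hk₀ : (k : ℝ) ≠ 0 := by exact_mod_cast (by omega : k ≠ 0)
  unfold vertexCount
  push_cast
  rw [Real.log_mul (by positivity) (by positivity), Real.log_pow, Real.log_pow, Nat.cast_sub hk]
  push_cast
  ring

theorem mainTerm_vertexCount {k : ℕ} (hk : 2 ≤ k) :
    mainTerm (vertexCount k) =
      k + Real.logb 2 (k ^ 2 / 2 * Real.log 2 / Real.log (vertexCount k) ^ 2) := by
  have hk' : (2 : ℝ) ≤ k := by exact_mod_cast hk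
  have hlog2 : 0 < Real.log 2 := Real.log_pos (by norm_num)
  have hlogn : 0 < Real.log (vertexCount k) := by
    rw [log_vertexCount (by omega)]
    have := Real.log_nonneg (by linarith : (1 : ℝ) ≤ k)
    nlinarith
  have hn : (vertexCount k : ℝ) = 2 ^ k * (k ^ 2 / 2) := by
    rw [← vertexCount_mul_half_pow (k := k) (by omega), mul_left_comm, ← mul_pow]
    norm_num
  rw [mainTerm, Real.logb_div (by positivity) (by positivity), Real.logb_mul (by positivity)
    hlog2.ne', Real.logb_pow]
  nth_rw 1 [hn]
  rw [Real.logb_mul (by positivity) (by positivity), Real.logb_pow, Real.logb_self_eq_one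
    (by norm_num)]
  push_cast
  ring

/-- Here `ln n ≥ k ln 2`, so the correction is at most `log₂ (1 / (2 ln 2))`, negative because `ln 2
> 1/2`. -/
theorem mainTerm_vertexCount_le {k : ℕ} (hk : 2 ≤ k) : mainTerm (vertexCount k) ≤ k := by
  have hk' : (2 : ℝ) ≤ k := by exact_mod_cast hk
  have hlog2 := Real.log_two_gt_d9
  have hlogk : Real.log 2 ≤ Real.log k := Real.log_le_log (by norm_num) hk'
  rw [mainTerm_vertexCount hk]
  have hlogn : k * Real.log 2 ≤ Real.log (vertexCount k) := by
    rw [log_vertexCount (by omega)]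
    linarith
  have : Real.logb 2 (k ^ 2 / 2 * Real.log 2 / Real.log (vertexCount k) ^ 2) ≤ 0 := by
    refine Real.logb_nonpos (by norm_num) (by positivity) (div_le_one_of_le₀ ?_ (by positivity))
    calc (k : ℝ) ^ 2 / 2 * Real.log 2 ≤ (k * Real.log 2) ^ 2 := by nlinarith [sq_nonneg (k : ℝ)]
      _ ≤ _ := by gcongr
  linarith

theorem eventually_le_mainTerm_vertexCount :
    ∀ᶠ k : ℕ in atTop, (k : ℝ) - 2 ≤ mainTerm (vertexCount k) := by
  filter_upwards [eventually_ge_atTop 10, eventually_log_le (by norm_num : (0 : ℝ) < 1 / 10)]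
    with k hk hlog
  have hk' : (10 : ℝ) ≤ k := by exact_mod_cast hk
  have hlog2 := Real.log_two_gt_d9
  have hlog2' := Real.log_two_lt_d9
  have hlogk : Real.log k ≤ Real.log (k + 1) := Real.log_le_log (by positivity) (by linarith)
  have hlogk₀ : 0 ≤ Real.log k := Real.log_nonneg (by linarith)
  have hlogn := log_vertexCount (by omega : 1 ≤ k)
  have hlogn₀ : 0 < Real.log (vertexCount k) := by rw [hlogn]; nlinarith
  have hlogn₁ : Real.log (vertexCount k) ≤ k := by rw [hlogn]; nlinarith
  rw [mainTerm_vertexCount (by omega)]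
  -- Using `ln n ≤ k`, the argument is at least `ln 2 / 2`, which exceeds `1/4`.
  have : (-2 : ℝ) ≤ Real.logb 2 (k ^ 2 / 2 * Real.log 2 / Real.log (vertexCount k) ^ 2) := by
    rw [Real.le_logb_iff_rpow_le (by norm_num) (by positivity), le_div_iff₀ (by positivity)]
    calc (2 : ℝ) ^ (-2 : ℝ) * Real.log (vertexCount k) ^ 2 ≤ (2 : ℝ) ^ (-2 : ℝ) * (k : ℝ) ^ 2 := by
          gcongr
      _ ≤ _ := by
          rw [show (2 : ℝ) ^ (-2 : ℝ) = 1 / 4 by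
            rw [Real.rpow_neg (by norm_num)]
            norm_num]
          nlinarith [sq_nonneg (k : ℝ)]
  linarith

theorem tendsto_prob_of_eventually_hasDepths {P : ∀ k, SimpleGraph (Fin (vertexCount k)) → Prop}
    (h : ∀ᶠ k in atTop, ∀ G, HasDepths k G → P k G) :
    Tendsto (fun j => prob (vertexCount (j + 1)) (P (j + 1))) atTop (𝓝 1) := by
  refine Tendsto.comp (g := fun k => prob (vertexCount k) (P k)) ?_ (tendsto_add_atTop_nat 1)
  refine tendsto_of_tendsto_of_tendsto_of_le_of_le' tendsto_prob_hasDepths tendsto_const_nhds ?_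
    (Eventually.of_forall fun k => prob_le_one _ _)
  filter_upwards [h] with k hk using prob_mono hk

end Asymptotics

end FirstOrderComplexity

open FirstOrderComplexity in
theorem mainTheorem3 :
    ∃ n : ℕ → ℕ, StrictMono n ∧
      -- the `o(1)` terms
      ∃ ε : ℕ → ℝ, Filter.Tendsto ε Filter.atTop (nhds 0) ∧
      -- the upper bound on `D_2`, with high probability
      Filter.Tendsto (fun j => prob (n j) fun G =>
          ∃ d : ℕ, defDepthAlt 2 G = d ∧ (d : ℝ) ≤ mainTerm (n j) + 6 + ε j)
        Filter.atTop (nhds 1) ∧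
      -- the lower bound on `D`, with high probability
      Filter.Tendsto (fun j => prob (n j) fun G =>
          ∃ d : ℕ, defDepth G = d ∧ mainTerm (n j) + 1 - ε j ≤ (d : ℝ))
        Filter.atTop (nhds 1) ∧
      -- concentration of `D` and `D_2` on five consecutive values
      ∃ a : ℕ → ℕ,
        Filter.Tendsto (fun j => prob (n j) fun G =>
            ((a j : ℕ∞) ≤ defDepth G ∧ defDepth G ≤ (a j + 4 : ℕ)) ∧
            ((a j : ℕ∞) ≤ defDepthAlt 2 G ∧ defDepthAlt 2 G ≤ (a j + 4 : ℕ)))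
          Filter.atTop (nhds 1) := by
  -- With `k = j + 1 ≥ 1`, the interval starts at `a j = k + 1`. The proof yields the four values up
  -- to `k + 4`, so the fifth is slack.
  refine ⟨fun j => vertexCount (j + 1),
    strictMono_nat_of_lt_succ fun j => vertexCount_lt (by omega) (by omega), fun _ => 0,
    tendsto_const_nhds, ?_, ?_, fun j => j + 1 + 1, ?_⟩
  · refine tendsto_prob_of_eventually_hasDepths (P := fun k G => ∃ d : ℕ, defDepthAlt 2 G = d ∧
      (d : ℝ) ≤ mainTerm (vertexCount k) + 6 + 0) ?_
    filter_upwards [eventually_le_mainTerm_vertexCount] with k hk G hG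
    obtain ⟨-, -, hle⟩ := hG
    obtain ⟨d, hd, hd'⟩ := ENat.le_natCast_iff.1 hle
    refine ⟨d, hd, ?_⟩
    have : (d : ℝ) ≤ ((k + 4 : ℕ) : ℝ) := by exact_mod_cast hd'
    push_cast at this
    linarith
  · refine tendsto_prob_of_eventually_hasDepths (P := fun k G => ∃ d : ℕ, defDepth G = d ∧
      mainTerm (vertexCount k) + 1 - 0 ≤ (d : ℝ)) ?_
    filter_upwards [Filter.eventually_ge_atTop 2] with k hk G hG
    obtain ⟨hge, h₁, h₂⟩ := hG
    obtain ⟨d, hd, -⟩ := ENat.le_natCast_iff.1 (h₁.trans h₂)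
    refine ⟨d, hd, ?_⟩
    rw [hd] at hge
    have : ((k + 1 : ℕ) : ℝ) ≤ d := by exact_mod_cast hge
    push_cast at this
    linarith [mainTerm_vertexCount_le hk]
  · refine tendsto_prob_of_eventually_hasDepths (P := fun k G =>
      (((k + 1 : ℕ) : ℕ∞) ≤ defDepth G ∧ defDepth G ≤ (k + 1 + 4 : ℕ)) ∧
        (((k + 1 : ℕ) : ℕ∞) ≤ defDepthAlt 2 G ∧ defDepthAlt 2 G ≤ (k + 1 + 4 : ℕ)))
      (Filter.Eventually.of_forall fun k G ⟨h₁, h₂, h₃⟩ => ?_)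
    have h₄ : defDepthAlt 2 G ≤ (k + 1 + 4 : ℕ) := h₃.trans (by exact_mod_cast (by omega))
    exact ⟨⟨h₁, h₂.trans h₄⟩, h₁.trans h₂, h₄⟩
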